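/- Let $m,n\ge 1$ be relatively prime integers with $m\le n$, let $\mathbb D$ be the open unit disc in $\mathbb C$, let $A_{m,n}=\{(z,w)\in\mathbb D^2: z^m=w^n\}$, and let $p(\lambda)=(\lambda^n,\lambda^m)$ for $\lambda\in\mathbb D$. For $X=A_{m,n}\subset\mathbb C^2$ or $X=\mathbb D\subset\mathbb C$ let $$c_X(\zeta,\eta)=\tanh^{-1}\,\sup_f\left|\frac{f(\zeta)-f(\eta)}{1-f(\zeta)\overline{f(\eta)}}\right|,$$ the supremum being taken over all $f:X\to\mathbb D$ that are locally restrictions of holomorphic functions on open subsets of the ambient space, be the Carathéodory distance of $X$. Let $c^i_{A_{m,n}}(\zeta,\eta)$, the inner Carathéodory distance, be the infimum of the $c_{A_{m,n}}$-lengths of all norm-rectifiable curves in $A_{m,n}$ connecting $\zeta$ and $\eta$. Let $\lambda,\mu\in\mathbb D$. (a) If $\operatorname{Re}(\lambda\bar\mu)\ge\cos(\pi/m)|\lambda\mu|$, then $c^i_{A_{m,n}}(p(\lambda),p(\mu))=c_{A_{m,n}}(p(\lambda),p(\mu))$. (b) If $\operatorname{Re}(\lambda\bar\mu)<\cos(\pi/m)|\lambda\mu|$,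 then $c^i_{A_{m,n}}(p(\lambda),p(\mu))=c_{A_{m,n}}(p(\lambda),p(\mu))$ if and only if $(\lambda\bar\mu)^m<0$, i.e. $(\lambda\bar\mu)^m$ is a negative real number. Thus the following conditions are equivalent: (i) $c^i_{A_{m,n}}(p(\lambda),p(\mu))=c_{A_{m,n}}(p(\lambda),p(\mu))$; (ii) $c^i_{A_{m,n}}(p(\lambda),p(\mu))=c_{\mathbb D}(\lambda^m,\mu^m)$; (iii) $\operatorname{Re}(\lambda\bar\mu)\ge\cos(\pi/m)|\lambda\mu|$ or $(\lambda\bar\mu)^m<0$. In particular, if $m>1$, then $c_{A_{m,n}}$ is not inner, i.e. $c_{A_{m,n}}\ne c^i_{A_{m,n}}$ as functions on $A_{m,n}\times A_{m,n}$. -/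

import Mathlib

open scoped ENNReal ComplexConjugate

noncomputable section

/-- The Möbius distance `|(a - b) / (1 - a * conj b)|` of two points of the open unit disc. -/
def moebiusDist (a b : ℂ) : ℝ :=
  ‖(a - b) / (1 - a * conj b)‖

/-- The open unit disc in the complex plane. -/
def unitDisc : Set ℂ :=
  Metric.ball (0 : ℂ) 1

/-- `f` is holomorphic on the subset `X` of the complex space `E`: around every point of `X` it
coincides on `X` with a holomorphic function on an open subset of `E`.
The values of `f` outside `X` play no role. -/
def HolomorphicOnSubset {E : Type*} [NormedAddCommGroup E] [NormedSpace ℂ E]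
    (X : Set E) (f : E → ℂ) : Prop :=
  ∀ x ∈ X, ∃ (U : Set E) (F : E → ℂ), IsOpen U ∧ x ∈ U ∧ DifferentiableOn ℂ F U ∧
    ∀ y ∈ X ∩ U, f y = F y

/-- The Möbius function of `X`: the supremum of `moebiusDist (f x) (f y)` over all holomorphic
functions `f` from `X` to the unit disc. -/
def moebiusFn {E : Type*} [NormedAddCommGroup E] [NormedSpace ℂ E]
    (X : Set E) (x y : E) : ℝ :=
  sSup {r : ℝ | ∃ f : E → ℂ, HolomorphicOnSubset X f ∧ Set.MapsTo f X unitDisc ∧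
    r = moebiusDist (f x) (f y)}

/-- The Carathéodory distance of `X`. -/
def caratheodoryDist {E : Type*} [NormedAddCommGroup E] [NormedSpace ℂ E]
    (X : Set E) (x y : E) : ℝ :=
  Real.artanh (moebiusFn X x y)

/-- The length of `α : [0, 1] → X` with respect to the Carathéodory distance of `X`: the supremum
over all subdivisions of `[0, 1]` of the sums of the distances of consecutive points. -/
def caratheodoryLength {E : Type*} [NormedAddCommGroup E] [NormedSpace ℂ E]
    (X : Set E) (α : ℝ → E) : ℝ≥0∞ :=
  ⨆ p : ℕ × {u : ℕ → ℝ // Monotone u ∧ ∀ i, u i ∈ Set.Icc (0 : ℝ) 1},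
    ∑ i ∈ Finset.range p.1,
      ENNReal.ofReal (caratheodoryDist X (α (p.2.1 i)) (α (p.2.1 (i + 1))))

/-- `α` restricted to `[0, 1]` is a norm-rectifiable (continuous) curve in `X` from `x` to `y`. -/
def IsRectifiableCurve {E : Type*} [NormedAddCommGroup E]
    (X : Set E) (x y : E) (α : ℝ → E) : Prop :=
  ContinuousOn α (Set.Icc 0 1) ∧ Set.MapsTo α (Set.Icc 0 1) X ∧
    BoundedVariationOn α (Set.Icc 0 1) ∧ α 0 = x ∧ α 1 = y

/-- The inner Carathéodory distance of `X`: the infimum of the Carathéodory lengths of the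
rectifiable curves in `X` from `x` to `y`. -/
def innerCaratheodoryDist {E : Type*} [NormedAddCommGroup E] [NormedSpace ℂ E]
    (X : Set E) (x y : E) : ℝ≥0∞ :=
  ⨅ (α : ℝ → E) (_ : IsRectifiableCurve X x y α), caratheodoryLength X α

/-- The Carathéodory distance of `X` is inner, that is, equal to its associated inner distance. -/
def CaratheodoryDistIsInner {E : Type*} [NormedAddCommGroup E] [NormedSpace ℂ E]
    (X : Set E) : Prop :=
  ∀ x ∈ X, ∀ y ∈ X, innerCaratheodoryDist X x y = ENNReal.ofReal (caratheodoryDist X x y)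

/-- The generalized Neil parabola `{(z, w) ∈ 𝔻² : z ^ m = w ^ n}`. -/
def neilParabola (m n : ℕ) : Set (ℂ × ℂ) :=
  {q | q.1 ∈ unitDisc ∧ q.2 ∈ unitDisc ∧ q.1 ^ m = q.2 ^ n}

/-- The parametrization `t ↦ (t ^ n, t ^ m)` of the generalized Neil parabola. -/
def neilParam (m n : ℕ) (t : ℂ) : ℂ × ℂ :=
  (t ^ n, t ^ m)

/-- The complex number `z` is real and negative. -/
def IsNegativeReal (z : ℂ) : Prop :=
  z.im = 0 ∧ z.re < 0

end

/-!
Write `A` for the Neil parabola and `p = neilParam m n`. Everything is transferred to the parameter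
disc, where the comparison object is the pull-back of the Poincaré distance under `z ↦ z ^ m`.

*Functions on `A`.* Since `n ≥ m`, a holomorphic `f : A → 𝔻` satisfies
`f (p z) - f (p 0) = O(z ^ m)`, so that after a disc automorphism `f (p z) = z ^ m * g z` with `g`
holomorphic into the closed disc (`exists_moebiusDist_eq`). The coordinate `w` shows that `c_A` is
at least the pull-back distance. Conversely, a Schwarz–Pick lemma of order `m`
(`norm_deriv_pow_mul_le`) says that `z ^ m * g z` contracts the pull-back metric infinitesimally, and
a differential inequality bounds `c_A` along a curve by the length of its image under `z ^ m`
(`caratheodoryDist_le_sub_of_norm_deriv_le`).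

*Upper bound for the inner distance.* If the angle between `a` and `b` is less than `π / m`, the
hyperbolic geodesic from `a ^ m` to `b ^ m` lifts to a curve from `a` to `b`. If `a ^ m` and `b ^ m`
lie on opposite sides of `0`, the two radii through the cusp do the same. In both cases the inner
distance is at most the Poincaré distance of `a ^ m` and `b ^ m`
(`innerCaratheodoryDist_le_poincareDist_pow`), hence both are equal to `c_A`.

*Strictness.* If the angle exceeds `π / m`, any curve from `a` to `b` meets a parameter `c` for which
`a ^ m` and `c ^ m` are opposite, so that it is at least as long as the path through the cusp
(`add_le_innerCaratheodoryDist`). On the other hand `c_A` is strictly smaller than the length of that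
path unless `a ^ m` and `b ^ m` are opposite (`caratheodoryDist_neilParam_lt_add`): equality would
force `g a = g b` to be unimodular.
-/

open Filter Topology Set

/-! ### The Möbius distance -/

theorem mem_unitDisc {z : ℂ} : z ∈ unitDisc ↔ ‖z‖ < 1 := by
  simp [unitDisc]

theorem one_sub_mul_conj_ne_zero {a b : ℂ} (ha : ‖a‖ < 1) (hb : ‖b‖ ≤ 1) :
    1 - a * conj b ≠ 0 := by
  intro h
  have h1 : ‖a * conj b‖ = 1 := by rw [← sub_eq_zero.mp h]; simp
  rw [norm_mul, RCLike.norm_conj] at h1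
  nlinarith [norm_nonneg a, norm_nonneg b]

theorem sq_norm_one_sub_mul_conj (a b : ℂ) :
    ‖1 - a * conj b‖ ^ 2 - ‖a - b‖ ^ 2 = (1 - ‖a‖ ^ 2) * (1 - ‖b‖ ^ 2) := by
  simp only [← Complex.normSq_eq_norm_sq, Complex.normSq_apply, Complex.sub_re, Complex.sub_im,
    Complex.mul_re, Complex.mul_im, Complex.conj_re, Complex.conj_im, Complex.one_re,
    Complex.one_im]
  ring

theorem moebiusDist_nonneg (a b : ℂ) : 0 ≤ moebiusDist a b := norm_nonneg _

theorem moebiusDist_zero_left (a : ℂ) : moebiusDist 0 a = ‖a‖ := by simp [moebiusDist]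

theorem moebiusDist_comm (a b : ℂ) : moebiusDist a b = moebiusDist b a := by
  unfold moebiusDist
  rw [norm_div, norm_div, norm_sub_rev a b, ← RCLike.norm_conj (1 - a * conj b)]
  simp [mul_comm]

/-- The square of the Möbius distance, in a form from which bounds are easily read off. -/
theorem sq_moebiusDist {a b : ℂ} (ha : ‖a‖ < 1) (hb : ‖b‖ ≤ 1) :
    moebiusDist a b ^ 2 = 1 - (1 - ‖a‖ ^ 2) * (1 - ‖b‖ ^ 2) / ‖1 - a * conj b‖ ^ 2 := by
  have h0 : ‖1 - a * conj b‖ ≠ 0 := norm_ne_zero_iff.mpr (one_sub_mul_conj_ne_zero ha hb)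
  rw [← sq_norm_one_sub_mul_conj, moebiusDist, norm_div]
  field_simp
  ring

theorem moebiusDist_lt_one {a b : ℂ} (ha : ‖a‖ < 1) (hb : ‖b‖ < 1) : moebiusDist a b < 1 := by
  have h := sq_moebiusDist ha hb.le
  have h0 : 0 < ‖1 - a * conj b‖ := norm_pos_iff.mpr (one_sub_mul_conj_ne_zero ha hb.le)
  have h1 : 0 < 1 - ‖a‖ ^ 2 := by nlinarith [norm_nonneg a]
  have h2 : 0 < 1 - ‖b‖ ^ 2 := by nlinarith [norm_nonneg b]
  have : 0 < (1 - ‖a‖ ^ 2) * (1 - ‖b‖ ^ 2) / ‖1 - a * conj b‖ ^ 2 := by positivity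
  nlinarith [moebiusDist_nonneg a b]

/-- The disc automorphism that sends `a` to `0`. -/
noncomputable def discAut (a z : ℂ) : ℂ := (z - a) / (1 - z * conj a)

theorem norm_discAut (a z : ℂ) : ‖discAut a z‖ = moebiusDist z a := rfl

theorem norm_discAut_lt_one {a z : ℂ} (ha : ‖a‖ < 1) (hz : ‖z‖ < 1) : ‖discAut a z‖ < 1 :=
  moebiusDist_lt_one hz ha

theorem discAut_self (a : ℂ) : discAut a a = 0 := by simp [discAut]

theorem discAut_neg_zero (a : ℂ) : discAut (-a) 0 = a := by simp [discAut]

theorem discAut_neg_discAut {a z : ℂ} (ha : ‖a‖ < 1) (hz : ‖z‖ < 1) :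
    discAut (-a) (discAut a z) = z := by
  have h1 := one_sub_mul_conj_ne_zero hz ha.le
  have h2 := one_sub_mul_conj_ne_zero ha ha.le
  have h3 : (1 - z * conj a) + (z - a) * conj a ≠ 0 := by
    convert h2 using 1; ring
  unfold discAut
  have h4 : 1 - (z - a) / (1 - z * conj a) * conj (-a)
      = (1 - a * conj a) / (1 - z * conj a) := by
    rw [map_neg]; field_simp; ring
  rw [h4]
  field_simp
  ring

theorem moebiusDist_discAut {c a b : ℂ} (hc : ‖c‖ < 1) (ha : ‖a‖ < 1) (hb : ‖b‖ < 1) :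
    moebiusDist (discAut c a) (discAut c b) = moebiusDist a b := by
  have h1 := one_sub_mul_conj_ne_zero ha hc.le
  have h2 := one_sub_mul_conj_ne_zero hb hc.le
  have h2' : 1 - conj b * c ≠ 0 := by
    have := one_sub_mul_conj_ne_zero hc hb.le
    rwa [mul_comm] at this
  have h3 := one_sub_mul_conj_ne_zero hc hc.le
  have h4 := one_sub_mul_conj_ne_zero ha hb.le
  have e1 : discAut c a - discAut c b
      = (1 - c * conj c) * (a - b) / ((1 - a * conj c) * (1 - b * conj c)) := by
    unfold discAut
    rw [div_sub_div _ _ h1 h2]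
    congr 1
    ring
  have e2 : 1 - discAut c a * conj (discAut c b)
      = (1 - c * conj c) * (1 - a * conj b) / ((1 - a * conj c) * (1 - conj b * c)) := by
    unfold discAut
    simp only [map_div₀, map_sub, map_mul, map_one, Complex.conj_conj]
    rw [div_mul_div_comm, one_sub_div (mul_ne_zero h1 h2')]
    congr 1
    ring
  have e3 : ‖1 - conj b * c‖ = ‖1 - b * conj c‖ := by
    rw [← RCLike.norm_conj (1 - b * conj c)]; simp
  have n1 := norm_ne_zero_iff.mpr h1
  have n2 := norm_ne_zero_iff.mpr h2
  have n3 := norm_ne_zero_iff.mpr h3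
  have n4 := norm_ne_zero_iff.mpr h4
  unfold moebiusDist
  rw [e1, e2]
  simp only [norm_div, norm_mul, e3]
  generalize ‖1 - a * conj c‖ = x1 at *
  generalize ‖1 - b * conj c‖ = x2 at *
  field_simp

theorem moebiusDist_le_add_div {a b : ℂ} (ha : ‖a‖ < 1) (hb : ‖b‖ < 1) :
    moebiusDist a b ≤ (‖a‖ + ‖b‖) / (1 + ‖a‖ * ‖b‖) := by
  have h0 : 0 < ‖1 - a * conj b‖ := norm_pos_iff.mpr (one_sub_mul_conj_ne_zero ha hb.le)
  have hle : ‖1 - a * conj b‖ ≤ 1 + ‖a‖ * ‖b‖ := by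
    refine (norm_sub_le _ _).trans ?_
    simp
  have h1 : 0 ≤ 1 - ‖a‖ ^ 2 := by nlinarith [norm_nonneg a]
  have h2 : 0 ≤ 1 - ‖b‖ ^ 2 := by nlinarith [norm_nonneg b]
  have hp : 0 < 1 + ‖a‖ * ‖b‖ := by positivity
  refine le_of_sq_le_sq ?_ (by positivity)
  rw [sq_moebiusDist ha hb.le]
  have : ((‖a‖ + ‖b‖) / (1 + ‖a‖ * ‖b‖)) ^ 2
      = 1 - (1 - ‖a‖ ^ 2) * (1 - ‖b‖ ^ 2) / (1 + ‖a‖ * ‖b‖) ^ 2 := by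
    field_simp; ring
  rw [this]
  gcongr

/-- The Möbius distance of `a` and `b` is as large as the moduli allow only if `a` and `b` lie on
opposite sides of the origin. -/
theorem mul_conj_eq_of_add_div_le_moebiusDist {a b : ℂ} (ha : ‖a‖ < 1) (hb : ‖b‖ < 1)
    (h : (‖a‖ + ‖b‖) / (1 + ‖a‖ * ‖b‖) ≤ moebiusDist a b) :
    a * conj b = -((‖a‖ * ‖b‖ : ℝ) : ℂ) := by
  have h0 : 0 < ‖1 - a * conj b‖ := norm_pos_iff.mpr (one_sub_mul_conj_ne_zero ha hb.le)
  have h1 : 0 < 1 - ‖a‖ ^ 2 := by nlinarith [norm_nonneg a]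
  have h2 : 0 < 1 - ‖b‖ ^ 2 := by nlinarith [norm_nonneg b]
  have hp : 0 < 1 + ‖a‖ * ‖b‖ := by positivity
  have hsq : ((‖a‖ + ‖b‖) / (1 + ‖a‖ * ‖b‖)) ^ 2 ≤ moebiusDist a b ^ 2 := by gcongr
  have : ((‖a‖ + ‖b‖) / (1 + ‖a‖ * ‖b‖)) ^ 2
      = 1 - (1 - ‖a‖ ^ 2) * (1 - ‖b‖ ^ 2) / (1 + ‖a‖ * ‖b‖) ^ 2 := by
    field_simp; ring
  rw [this, sq_moebiusDist ha hb.le, sub_le_sub_iff_left,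
    div_le_div_iff_of_pos_left (by positivity) (by positivity) (by positivity)] at hsq
  have hle : 1 + ‖a‖ * ‖b‖ ≤ ‖1 - a * conj b‖ := le_of_sq_le_sq hsq h0.le
  set w := a * conj b with hw
  have hn : ‖w‖ = ‖a‖ * ‖b‖ := by simp [hw]
  rw [← hn] at hle ⊢
  have hs : ‖w‖ ^ 2 = w.re ^ 2 + w.im ^ 2 := by
    rw [← Complex.normSq_eq_norm_sq, Complex.normSq_apply]; ring
  have hs2 : ‖1 - w‖ ^ 2 = (1 - w.re) ^ 2 + w.im ^ 2 := by
    rw [← Complex.normSq_eq_norm_sq, Complex.normSq_apply]; simp; ring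
  have hre : w.re = -‖w‖ := by
    have := Complex.abs_re_le_norm w
    have := abs_le.mp this
    have h5 : (1 + ‖w‖) ^ 2 ≤ ‖1 - w‖ ^ 2 := by gcongr
    nlinarith [norm_nonneg w]
  have him : w.im = 0 := by
    have : w.im ^ 2 = 0 := by rw [hre] at hs; nlinarith
    exact pow_eq_zero_iff two_ne_zero |>.mp this
  apply Complex.ext <;> simp [hre, him]

theorem moebiusDist_eq_add_div {a b : ℂ} (hab : a * conj b = -((‖a‖ * ‖b‖ : ℝ) : ℂ))
    (ha : ‖a‖ < 1) (hb : ‖b‖ < 1) :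
    moebiusDist a b = (‖a‖ + ‖b‖) / (1 + ‖a‖ * ‖b‖) := by
  have hp : 0 < 1 + ‖a‖ * ‖b‖ := by positivity
  refine (sq_eq_sq₀ (moebiusDist_nonneg a b) (by positivity)).mp ?_
  have : 1 - a * conj b = ((1 + ‖a‖ * ‖b‖ : ℝ) : ℂ) := by rw [hab]; push_cast; ring
  rw [sq_moebiusDist ha hb.le, this, Complex.norm_real, Real.norm_of_nonneg hp.le]
  field_simp; ring

theorem artanh_add {x y : ℝ} (hx0 : 0 ≤ x) (hx : x < 1) (hy0 : 0 ≤ y) (hy : y < 1) :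
    Real.artanh ((x + y) / (1 + x * y)) = Real.artanh x + Real.artanh y := by
  have hp : 0 < 1 + x * y := by positivity
  have hlt : (x + y) / (1 + x * y) ≤ 1 := by
    rw [div_le_one hp]; nlinarith
  rw [Real.artanh_eq_half_log ⟨by linarith, hx.le⟩, Real.artanh_eq_half_log ⟨by linarith, hy.le⟩,
    Real.artanh_eq_half_log ⟨by linarith [show 0 ≤ (x + y) / (1 + x * y) by positivity], hlt⟩,
    ← mul_add, ← Real.log_mul]
  · congr 2
    have h1 : 1 - x ≠ 0 := by linarith
    have h2 : 1 - y ≠ 0 := by linarith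
    have e1 : 1 + (x + y) / (1 + x * y) = (1 + x) * (1 + y) / (1 + x * y) := by field_simp; ring
    have e2 : 1 - (x + y) / (1 + x * y) = (1 - x) * (1 - y) / (1 + x * y) := by field_simp; ring
    rw [e1, e2]
    field_simp
  · exact div_ne_zero (by linarith) (by linarith)
  · exact div_ne_zero (by linarith) (by linarith)

theorem add_div_lt_one {x y : ℝ} (hx0 : 0 ≤ x) (hx : x < 1) (hy0 : 0 ≤ y) (hy : y < 1) :
    (x + y) / (1 + x * y) < 1 := by
  rw [div_lt_one (by positivity)]
  nlinarith

/-- The Poincaré distance of two points of the disc. -/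
noncomputable def poincareDist (a b : ℂ) : ℝ := Real.artanh (moebiusDist a b)

theorem poincareDist_nonneg (a b : ℂ) : 0 ≤ poincareDist a b :=
  Real.artanh_nonneg (moebiusDist_nonneg a b)

theorem poincareDist_comm (a b : ℂ) : poincareDist a b = poincareDist b a := by
  rw [poincareDist, moebiusDist_comm, poincareDist]

theorem poincareDist_le_artanh_norm_add {a b : ℂ} (ha : ‖a‖ < 1) (hb : ‖b‖ < 1) :
    poincareDist a b ≤ Real.artanh ‖a‖ + Real.artanh ‖b‖ := by
  rw [← artanh_add (norm_nonneg a) ha (norm_nonneg b) hb]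
  exact Real.artanh_le_artanh (by linarith [moebiusDist_nonneg a b])
    (add_div_lt_one (norm_nonneg a) ha (norm_nonneg b) hb) (moebiusDist_le_add_div ha hb)

theorem poincareDist_eq_add {a b : ℂ} (hab : a * conj b = -((‖a‖ * ‖b‖ : ℝ) : ℂ))
    (ha : ‖a‖ < 1) (hb : ‖b‖ < 1) :
    poincareDist a b = Real.artanh ‖a‖ + Real.artanh ‖b‖ := by
  rw [← artanh_add (norm_nonneg a) ha (norm_nonneg b) hb, poincareDist,
    moebiusDist_eq_add_div hab ha hb]

theorem poincareDist_triangle {a b c : ℂ} (ha : ‖a‖ < 1) (hb : ‖b‖ < 1) (hc : ‖c‖ < 1) :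
    poincareDist a c ≤ poincareDist a b + poincareDist b c := by
  have h := poincareDist_le_artanh_norm_add (norm_discAut_lt_one hb ha) (norm_discAut_lt_one hb hc)
  rw [poincareDist, moebiusDist_discAut hb ha hc, norm_discAut, norm_discAut] at h
  rwa [poincareDist_comm b c]

/-! ### The Schwarz–Pick lemma -/

theorem differentiableOn_discAut {a : ℂ} (ha : ‖a‖ < 1) :
    DifferentiableOn ℂ (discAut a) unitDisc := by
  intro z hz
  have := one_sub_mul_conj_ne_zero (mem_unitDisc.mp hz) ha.le
  unfold discAut
  exact DifferentiableAt.differentiableWithinAt (by fun_prop (disch := assumption))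

/-- The Schwarz–Pick lemma. -/
theorem moebiusDist_le_of_mapsTo {h : ℂ → ℂ} (hd : DifferentiableOn ℂ h unitDisc)
    (hm : MapsTo h unitDisc unitDisc) {a b : ℂ} (ha : ‖a‖ < 1) (hb : ‖b‖ < 1) :
    moebiusDist (h a) (h b) ≤ moebiusDist a b := by
  have hnb : ‖-b‖ < 1 := by simpa
  have hhb : ‖h b‖ < 1 := mem_unitDisc.mp (hm (mem_unitDisc.mpr hb))
  have hin : MapsTo (discAut (-b)) unitDisc unitDisc := fun z hz =>
    mem_unitDisc.mpr (norm_discAut_lt_one hnb (mem_unitDisc.mp hz))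
  have hout : MapsTo (discAut (h b)) unitDisc unitDisc := fun z hz =>
    mem_unitDisc.mpr (norm_discAut_lt_one hhb (mem_unitDisc.mp hz))
  have hF : DifferentiableOn ℂ (discAut (h b) ∘ h ∘ discAut (-b)) unitDisc :=
    (differentiableOn_discAut hhb).comp (hd.comp (differentiableOn_discAut hnb) hin)
      (hm.comp hin)
  have := Complex.norm_le_norm_of_mapsTo_ball (R := 1) hF
    (((hout.comp (hm.comp hin))).mono_right Metric.ball_subset_closedBall)
    (by simp [discAut_neg_zero, discAut_self]) (norm_discAut_lt_one hb ha)
  simpa [discAut_neg_discAut hb ha, norm_discAut] using this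

/-- The Schwarz–Pick lemma for maps into the closed disc, where the denominator of the Möbius
distance may vanish. -/
theorem norm_sub_mul_le_of_mapsTo_closedBall {g : ℂ → ℂ} (hd : DifferentiableOn ℂ g unitDisc)
    (hm : ∀ z ∈ unitDisc, ‖g z‖ ≤ 1) {a b : ℂ} (ha : ‖a‖ < 1) (hb : ‖b‖ < 1) :
    ‖g a - g b‖ ≤ moebiusDist a b * ‖1 - g a * conj (g b)‖ := by
  -- apply the lemma to `r g` and let `r` tend to `1` from the left
  have key : ∀ r : ℝ, r ∈ Ioo (0 : ℝ) 1 →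
      ‖r * g a - r * g b‖ ≤ moebiusDist a b * ‖1 - r * g a * conj (r * g b)‖ := by
    intro r hr
    have hlt : ∀ z ∈ unitDisc, ‖r * g z‖ < 1 := by
      intro z hz
      rw [norm_mul, Complex.norm_real, Real.norm_of_nonneg hr.1.le]
      nlinarith [hm z hz, hr.1, hr.2, norm_nonneg (g z)]
    have h := moebiusDist_le_of_mapsTo (h := fun z => r * g z) (hd.const_mul _)
      (fun z hz => mem_unitDisc.mpr (hlt z hz)) ha hb
    rw [moebiusDist, norm_div, div_le_iff₀] at h
    · exact h
    · exact norm_pos_iff.mpr (one_sub_mul_conj_ne_zero (hlt a (mem_unitDisc.mpr ha))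
        (hlt b (mem_unitDisc.mpr hb)).le)
  have hc1 : Continuous fun r : ℝ => ‖r * g a - r * g b‖ := by fun_prop
  have hc2 : Continuous fun r : ℝ => moebiusDist a b * ‖1 - r * g a * conj (r * g b)‖ := by
    simp only [map_mul, Complex.conj_ofReal]
    fun_prop
  have t1 := (hc1.tendsto 1).mono_left (nhdsWithin_le_nhds (s := Iio 1))
  have t2 := (hc2.tendsto 1).mono_left (nhdsWithin_le_nhds (s := Iio 1))
  have := le_of_tendsto_of_tendsto t1 t2 (by
    filter_upwards [Ioo_mem_nhdsLT (show (0 : ℝ) < 1 by norm_num)] with r hr using key r hr)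
  simpa using this

/-- The infinitesimal Schwarz–Pick lemma, for maps into the closed disc. -/
theorem norm_deriv_mul_le_of_mapsTo_closedBall {g : ℂ → ℂ} (hd : DifferentiableOn ℂ g unitDisc)
    (hm : ∀ z ∈ unitDisc, ‖g z‖ ≤ 1) {a : ℂ} (ha : ‖a‖ < 1) :
    ‖deriv g a‖ * (1 - ‖a‖ ^ 2) ≤ 1 - ‖g a‖ ^ 2 := by
  have ho : IsOpen unitDisc := Metric.isOpen_ball
  have hg : HasDerivAt g (deriv g a) a :=
    (hd.differentiableAt (ho.mem_nhds (mem_unitDisc.mpr ha))).hasDerivAt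
  have hself : ∀ z : ℂ, ‖z‖ ≤ 1 → ‖1 - z * conj z‖ = 1 - ‖z‖ ^ 2 := by
    intro z hz
    rw [Complex.mul_conj, Complex.normSq_eq_norm_sq, ← Complex.ofReal_one, ← Complex.ofReal_sub,
      Complex.norm_real, Real.norm_of_nonneg]
    nlinarith [norm_nonneg z]
  rw [← hself a ha.le, ← hself (g a) (hm a (mem_unitDisc.mpr ha))]
  have t1 : Tendsto (fun z => ‖slope g a z‖ * ‖1 - a * conj z‖) (𝓝[≠] a)
      (𝓝 (‖deriv g a‖ * ‖1 - a * conj a‖)) := by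
    refine (hasDerivAt_iff_tendsto_slope.mp hg).norm.mul ?_
    have : Continuous fun z : ℂ => ‖1 - a * conj z‖ := by fun_prop
    exact (this.tendsto a).mono_left nhdsWithin_le_nhds
  have t2 : Tendsto (fun z => ‖1 - g a * conj (g z)‖) (𝓝[≠] a) (𝓝 ‖1 - g a * conj (g a)‖) := by
    have h1 : Tendsto g (𝓝[≠] a) (𝓝 (g a)) := hg.continuousAt.tendsto.mono_left nhdsWithin_le_nhds
    have : Continuous fun w : ℂ => ‖1 - g a * conj w‖ := by fun_prop
    exact (this.tendsto (g a)).comp h1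
  refine le_of_tendsto_of_tendsto t1 t2 ?_
  filter_upwards [self_mem_nhdsWithin, mem_nhdsWithin_of_mem_nhds
    (ho.mem_nhds (mem_unitDisc.mpr ha))] with z hz hz1
  have hz' := mem_unitDisc.mp hz1
  have h := norm_sub_mul_le_of_mapsTo_closedBall hd hm ha hz'
  have hp : 0 < ‖1 - a * conj z‖ := norm_pos_iff.mpr (one_sub_mul_conj_ne_zero ha hz'.le)
  have hq : 0 < ‖z - a‖ := norm_pos_iff.mpr (sub_ne_zero.mpr hz)
  rw [moebiusDist, norm_div, norm_sub_rev a z, norm_sub_rev, div_mul_eq_mul_div,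
    le_div_iff₀ hp] at h
  rw [slope_def_field, norm_div, div_mul_eq_mul_div, div_le_iff₀ hq]
  linarith

/-! ### Functions vanishing to order `m` at the origin -/

/-- A holomorphic map of the disc into itself which vanishes to order `m` at the origin is
`z ^ m` times a holomorphic map into the closed disc. -/
theorem exists_eq_pow_mul {k : ℂ → ℂ} {m : ℕ} (hm : 1 ≤ m) (hd : DifferentiableOn ℂ k unitDisc)
    (hk : MapsTo k unitDisc unitDisc) (hO : k =O[𝓝 0] fun z => z ^ m) :
    ∃ g : ℂ → ℂ, DifferentiableOn ℂ g unitDisc ∧ (∀ z ∈ unitDisc, ‖g z‖ ≤ 1) ∧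
      ∀ z ∈ unitDisc, k z = z ^ m * g z := by
  have h0 : k 0 = 0 := by
    have := hO.eq_zero_imp.self_of_nhds
    exact this (zero_pow (by omega))
  have hlittle : (fun z => k z - k 0) =o[𝓝 0] fun z : ℂ => ‖z - 0‖ ^ (m - 1) := by
    simp only [h0, sub_zero]
    refine hO.trans_isLittleO ?_
    have := Asymptotics.isLittleO_pow_pow (𝕜 := ℂ) (show m - 1 < m by omega)
    simpa using this.norm_right
  have hle : ∀ z ∈ unitDisc, ‖k z‖ ≤ ‖z‖ ^ m := by
    intro z hz
    have := Complex.dist_le_mul_div_pow_of_mapsTo_ball_of_isLittleO (R₁ := 1) (R₂ := 1) hd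
      (by rw [h0]; exact hk.mono_right Metric.ball_subset_closedBall) hlittle hz
    simpa [h0, Nat.sub_add_cancel hm] using this
  have hmem : unitDisc ∈ 𝓝 (0 : ℂ) := Metric.isOpen_ball.mem_nhds (mem_unitDisc.mpr (by simp))
  have hq : ∀ z ∈ unitDisc, z ≠ 0 → ‖k z / z ^ m‖ ≤ 1 := by
    intro z hz hz0
    rw [norm_div, norm_pow, div_le_one (by positivity)]
    exact hle z hz
  have hdq : DifferentiableOn ℂ (fun z => k z / z ^ m) (unitDisc \ {0}) :=
    (hd.mono sdiff_subset).div (by fun_prop) (fun z hz => pow_ne_zero _ hz.2)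
  have hg := Complex.differentiableOn_update_limUnder_of_bddAbove hmem hdq
    ⟨1, by rintro _ ⟨z, hz, rfl⟩; exact hq z hz.1 hz.2⟩
  set g := Function.update (fun z => k z / z ^ m) 0 (limUnder (𝓝[≠] 0) fun z => k z / z ^ m)
    with hgdef
  have hgne : ∀ z, z ≠ 0 → g z = k z / z ^ m := fun z hz => by simp [hgdef, hz]
  refine ⟨g, hg, fun z hz => ?_, fun z hz => ?_⟩
  · rcases eq_or_ne z 0 with rfl | hz0
    · have hc : Tendsto g (𝓝[≠] 0) (𝓝 (g 0)) :=
        (hg.differentiableAt hmem).continuousAt.tendsto.mono_left nhdsWithin_le_nhds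
      refine le_of_tendsto hc.norm ?_
      filter_upwards [self_mem_nhdsWithin, mem_nhdsWithin_of_mem_nhds hmem] with z hz0 hz1
      rw [hgne z hz0]
      exact hq z hz1 hz0
    · rw [hgne z hz0]; exact hq z hz hz0
  · rcases eq_or_ne z 0 with rfl | hz0
    · simp [h0, show m ≠ 0 by omega]
    · rw [hgne z hz0]
      field_simp

/-- The elementary inequality behind the Schwarz–Pick lemma of order `m`; it is affine in `x`, and
at `x = 1` it follows by pairing the powers `r ^ (2 * i + 1)` and `r ^ (2 * (m - 1 - i) + 1)`. -/
theorem sum_pow_mul_le {r x : ℝ} (hr0 : 0 ≤ r) (hr1 : r ≤ 1) (hx0 : 0 ≤ x) (hx1 : x ≤ 1) (m : ℕ) :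
    r * (∑ i ∈ Finset.range m, (r ^ 2) ^ i) * (1 + x) ≤ m * (1 + r ^ (2 * m) * x) := by
  have h1 : ∑ i ∈ Finset.range m, (r ^ 2) ^ i * r ≤ m := by
    calc ∑ i ∈ Finset.range m, (r ^ 2) ^ i * r ≤ ∑ i ∈ Finset.range m, (1 : ℝ) :=
          Finset.sum_le_sum fun i _ =>
            mul_le_one₀ (pow_le_one₀ (by positivity) (pow_le_one₀ hr0 hr1)) hr0 hr1
      _ = m := by simp
  have h2 : 2 * ∑ i ∈ Finset.range m, (r ^ 2) ^ i * r ≤ m * (1 + r ^ (2 * m)) := by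
    calc 2 * ∑ i ∈ Finset.range m, (r ^ 2) ^ i * r
        = ∑ i ∈ Finset.range m, ((r ^ 2) ^ i * r + (r ^ 2) ^ (m - 1 - i) * r) := by
          rw [Finset.sum_add_distrib, Finset.sum_range_reflect (fun i => (r ^ 2) ^ i * r), two_mul]
      _ ≤ ∑ i ∈ Finset.range m, (1 + r ^ (2 * m)) := by
          refine Finset.sum_le_sum fun i hi => ?_
          have hi' := Finset.mem_range.mp hi
          have e : r ^ (2 * m) = ((r ^ 2) ^ i * r) * ((r ^ 2) ^ (m - 1 - i) * r) := by
            rw [← pow_mul, ← pow_mul, ← pow_succ, ← pow_succ, ← pow_add]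
            congr 1; omega
          have a1 : (r ^ 2) ^ i * r ≤ 1 :=
            mul_le_one₀ (pow_le_one₀ (by positivity) (pow_le_one₀ hr0 hr1)) hr0 hr1
          have a2 : (r ^ 2) ^ (m - 1 - i) * r ≤ 1 :=
            mul_le_one₀ (pow_le_one₀ (by positivity) (pow_le_one₀ hr0 hr1)) hr0 hr1
          rw [e]
          nlinarith
      _ = m * (1 + r ^ (2 * m)) := by simp; ring
  rw [Finset.mul_sum]
  simp_rw [mul_comm r]
  nlinarith [mul_nonneg hx0 (sub_nonneg.mpr h2), mul_nonneg (sub_nonneg.mpr hx1) (sub_nonneg.mpr h1)]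

/-- The Schwarz–Pick lemma of order `m`: the map `z ^ m * g z` is at `a` infinitesimally contracting
with respect to the pull-back of the Poincaré metric under `z ^ m`. -/
theorem norm_deriv_pow_mul_le {g : ℂ → ℂ} {m : ℕ} (hm : 1 ≤ m)
    (hd : DifferentiableOn ℂ g unitDisc) (hg : ∀ z ∈ unitDisc, ‖g z‖ ≤ 1) {a : ℂ} (ha : ‖a‖ < 1) :
    ‖deriv (fun z => z ^ m * g z) a‖ * (1 - ‖a ^ m‖ ^ 2) ≤
      (1 - ‖a ^ m * g a‖ ^ 2) * (m * ‖a‖ ^ (m - 1)) := by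
  have ho : IsOpen unitDisc := Metric.isOpen_ball
  have hga : HasDerivAt g (deriv g a) a :=
    (hd.differentiableAt (ho.mem_nhds (mem_unitDisc.mpr ha))).hasDerivAt
  have hder := ((hasDerivAt_pow m a).mul hga).deriv
  have hfun : (fun z : ℂ => z ^ m * g z) = (fun z => z ^ m) * g := rfl
  rw [hfun, hder]
  have hSP := norm_deriv_mul_le_of_mapsTo_closedBall hd hg ha
  have hx1 := hg a (mem_unitDisc.mpr ha)
  simp only [norm_mul, norm_pow]
  have htri : ‖(m : ℂ) * a ^ (m - 1) * g a + a ^ m * deriv g a‖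
      ≤ m * ‖a‖ ^ (m - 1) * ‖g a‖ + ‖a‖ ^ m * ‖deriv g a‖ := by
    refine (norm_add_le _ _).trans_eq ?_
    simp
  set r := ‖a‖
  set x := ‖g a‖
  set y := ‖deriv g a‖
  have hr0 : 0 ≤ r := norm_nonneg a
  have hx0 : 0 ≤ x := norm_nonneg _
  have hy0 : 0 ≤ y := norm_nonneg _
  have hgeom : (∑ i ∈ Finset.range m, (r ^ 2) ^ i) * (1 - r ^ 2) = 1 - r ^ (2 * m) := by
    rw [geom_sum_mul_neg, ← pow_mul]
  have hpm : r ^ m = r ^ (m - 1) * r := by rw [← pow_succ]; congr 1; omega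
  have hkey := sum_pow_mul_le hr0 ha.le hx0 hx1 m
  set S := ∑ i ∈ Finset.range m, (r ^ 2) ^ i
  have hS : 0 ≤ S := Finset.sum_nonneg fun i _ => by positivity
  have e2 : (r ^ m) ^ 2 = r ^ (2 * m) := by rw [← pow_mul, mul_comm]
  have hR1 : r ^ (2 * m) ≤ 1 := pow_le_one₀ hr0 ha.le
  refine (mul_le_mul_of_nonneg_right htri (by rw [e2]; linarith)).trans ?_
  rw [mul_pow, e2]
  set R := r ^ (2 * m)
  have hP : 0 ≤ r ^ (m - 1) := by positivity
  rw [hpm]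
  set P := r ^ (m - 1)
  -- divide by `P`, and bound `y * (1 - R) = S * (y * (1 - r ^ 2))` by `S * (1 - x ^ 2)`
  have h1 : y * (1 - R) ≤ S * (1 - x ^ 2) := by
    rw [← hgeom]; nlinarith
  have h2 : r * (y * (1 - R)) ≤ (1 - x) * (m * (1 + R * x)) := by
    calc r * (y * (1 - R)) ≤ r * (S * (1 - x ^ 2)) := by gcongr
      _ = (1 - x) * (r * S * (1 + x)) := by ring
      _ ≤ _ := mul_le_mul_of_nonneg_left hkey (by linarith)
  nlinarith [mul_le_mul_of_nonneg_left h2 hP]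

/-! ### Hyperbolic length of curves in the disc -/

theorem hasDerivAt_tanh (x : ℝ) : HasDerivAt Real.tanh (1 - Real.tanh x ^ 2) x := by
  have h := (Real.hasDerivAt_sinh x).div (Real.hasDerivAt_cosh x) (Real.cosh_pos x).ne'
  have hf : Real.tanh = Real.sinh / Real.cosh := by
    ext y; exact Real.tanh_eq_sinh_div_cosh y
  have h0 := (Real.cosh_pos x).ne'
  rw [Real.tanh_eq_sinh_div_cosh, hf]
  refine h.congr_deriv ?_
  field_simp

theorem hasDerivAt_artanh {x : ℝ} (h1 : -1 < x) (h2 : x < 1) :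
    HasDerivAt Real.artanh (1 / (1 - x ^ 2)) x := by
  have hp : 1 + x ≠ 0 := by linarith
  have hq : 1 - x ≠ 0 := by linarith
  have hd : HasDerivAt (fun y : ℝ => 1 / 2 * (Real.log (1 + y) - Real.log (1 - y)))
      (1 / 2 * (1 / (1 + x) - (-1) / (1 - x))) x :=
    ((((hasDerivAt_id x).const_add 1).log hp).sub
      (((hasDerivAt_id x).const_sub 1).log hq)).const_mul _
  have he : Real.artanh =ᶠ[𝓝 x] fun y => 1 / 2 * (Real.log (1 + y) - Real.log (1 - y)) := by
    filter_upwards [Ioo_mem_nhds h1 h2] with y hy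
    rw [Real.artanh_eq_half_log ⟨hy.1.le, hy.2.le⟩, Real.log_div (by linarith [hy.1])
      (by linarith [hy.2])]
  refine (hd.congr_of_eventuallyEq he).congr_deriv ?_
  have : 1 - x ^ 2 ≠ 0 := by
    rw [show 1 - x ^ 2 = (1 + x) * (1 - x) by ring]; exact mul_ne_zero hp hq
  field_simp
  ring

theorem hasDerivAt_artanh_comp {f : ℝ → ℝ} {f' x : ℝ} (hf : HasDerivAt f f' x) (h1 : -1 < f x)
    (h2 : f x < 1) : HasDerivAt (fun y => Real.artanh (f y)) (1 / (1 - f x ^ 2) * f') x :=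
  HasDerivAt.comp (h₂ := Real.artanh) x (hasDerivAt_artanh h1 h2) hf

theorem hasDerivAt_discAut {a z : ℂ} (ha : ‖a‖ < 1) (hz : ‖z‖ < 1) :
    HasDerivAt (discAut a) (((1 - ‖a‖ ^ 2 : ℝ) : ℂ) / (1 - z * conj a) ^ 2) z := by
  have h0 := one_sub_mul_conj_ne_zero hz ha.le
  have h := ((hasDerivAt_id z).sub_const a).div
    (((hasDerivAt_id z).mul_const (conj a)).const_sub 1) h0
  have e : (((1 - ‖a‖ ^ 2 : ℝ)) : ℂ) = 1 - a * conj a := by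
    rw [Complex.mul_conj, Complex.normSq_eq_norm_sq]; push_cast; ring
  rw [e]
  refine h.congr_deriv ?_
  simp only [id]
  congr 1
  ring

/-- If the hyperbolic speed of the curve `γ` is at most `T'`, then the Poincaré distance of its end
points is at most the increase of `T`. -/
theorem poincareDist_le_sub_of_norm_deriv_le {γ γ' : ℝ → ℂ} {T T' : ℝ → ℝ} {a b : ℝ} (hab : a ≤ b)
    (hγ1 : ∀ x ∈ Icc a b, ‖γ x‖ < 1) (hγ : ∀ x ∈ Icc a b, HasDerivAt γ (γ' x) x)
    (hT : ∀ x ∈ Icc a b, HasDerivAt T (T' x) x)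
    (hle : ∀ x ∈ Icc a b, ‖γ' x‖ ≤ (1 - ‖γ x‖ ^ 2) * T' x) :
    poincareDist (γ a) (γ b) ≤ T b - T a := by
  have ha := hγ1 a (left_mem_Icc.mpr hab)
  have hb := hγ1 b (right_mem_Icc.mpr hab)
  -- the fencing theorem needs a strict inequality, hence the additional slope `ε`
  have key : ∀ ε : ℝ, 0 < ε → poincareDist (γ a) (γ b) ≤ T b - T a + ε * (b - a) := by
    intro ε hε
    set B : ℝ → ℝ := fun x => Real.tanh (T x - T a + ε * (x - a)) with hB
    have hBd : ∀ x ∈ Icc a b, HasDerivAt B ((1 - B x ^ 2) * (T' x + ε)) x := by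
      intro x hx
      have h1 : HasDerivAt (fun x => T x - T a + ε * (x - a)) (T' x + ε * 1) x :=
        ((hT x hx).sub_const _).add (((hasDerivAt_id x).sub_const a).const_mul ε)
      rw [mul_one] at h1
      exact (hasDerivAt_tanh _).comp x h1
    have hNd : ∀ x ∈ Icc a b, HasDerivAt (fun y => discAut (γ a) (γ y))
        (((1 - ‖γ a‖ ^ 2 : ℝ) : ℂ) / (1 - γ x * conj (γ a)) ^ 2 * γ' x) x := fun x hx =>
      (hasDerivAt_discAut ha (hγ1 x hx)).comp x (hγ x hx)
    have := image_norm_le_of_norm_deriv_right_lt_deriv_boundary' (B := B)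
      (fun x hx => (hNd x hx).continuousAt.continuousWithinAt)
      (fun x hx => (hNd x (Ico_subset_Icc_self hx)).hasDerivWithinAt)
      (by simp [discAut_self, hB])
      (fun x hx => (hBd x hx).continuousAt.continuousWithinAt)
      (fun x hx => (hBd x (Ico_subset_Icc_self hx)).hasDerivWithinAt)
      (by
        intro x hx hxB
        have hx' := Ico_subset_Icc_self hx
        have hγx := hγ1 x hx'
        have h0 := one_sub_mul_conj_ne_zero hγx ha.le
        have hn : 0 < ‖1 - γ x * conj (γ a)‖ := norm_pos_iff.mpr h0
        have ha2 : 0 ≤ 1 - ‖γ a‖ ^ 2 := by nlinarith [norm_nonneg (γ a)]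
        have hsq : 1 - B x ^ 2
            = (1 - ‖γ x‖ ^ 2) * (1 - ‖γ a‖ ^ 2) / ‖1 - γ x * conj (γ a)‖ ^ 2 := by
          rw [← hxB, norm_discAut, sq_moebiusDist hγx ha.le]; ring
        have hpos : 0 < 1 - B x ^ 2 := by
          have := Real.tanh_sq_lt_one (T x - T a + ε * (x - a))
          simp only [hB]; linarith
        calc ‖((1 - ‖γ a‖ ^ 2 : ℝ) : ℂ) / (1 - γ x * conj (γ a)) ^ 2 * γ' x‖
            = (1 - ‖γ a‖ ^ 2) / ‖1 - γ x * conj (γ a)‖ ^ 2 * ‖γ' x‖ := by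
              rw [norm_mul, norm_div, norm_pow, Complex.norm_real, Real.norm_of_nonneg ha2]
          _ ≤ (1 - ‖γ a‖ ^ 2) / ‖1 - γ x * conj (γ a)‖ ^ 2 * ((1 - ‖γ x‖ ^ 2) * T' x) := by
              gcongr; exact hle x hx'
          _ = (1 - B x ^ 2) * T' x := by rw [hsq]; ring
          _ < (1 - B x ^ 2) * (T' x + ε) := by gcongr; linarith)
      (right_mem_Icc.mpr hab)
    rw [norm_discAut, moebiusDist_comm] at this
    have h2 := Real.artanh_le_artanh (by linarith [moebiusDist_nonneg (γ a) (γ b)])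
      (Real.tanh_lt_one _) this
    rwa [Real.artanh_tanh] at h2
  have hlim : Tendsto (fun ε : ℝ => T b - T a + ε * (b - a)) (𝓝[>] 0) (𝓝 (T b - T a)) := by
    have : Continuous fun ε : ℝ => T b - T a + ε * (b - a) := by fun_prop
    simpa using (this.tendsto 0).mono_left (nhdsWithin_le_nhds (s := Ioi 0))
  exact ge_of_tendsto hlim (by filter_upwards [self_mem_nhdsWithin] with ε hε using key ε hε)

/-! ### The Carathéodory distance -/

section Caratheodory

variable {E : Type*} [NormedAddCommGroup E] [NormedSpace ℂ E] {X : Set E} {x y : E}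

theorem moebiusFn_nonneg : 0 ≤ moebiusFn X x y := by
  refine Real.sSup_nonneg ?_
  rintro _ ⟨f, -, -, rfl⟩
  exact moebiusDist_nonneg _ _

theorem caratheodoryDist_nonneg : 0 ≤ caratheodoryDist X x y :=
  Real.artanh_nonneg moebiusFn_nonneg

theorem moebiusFn_le {q : ℝ} (hq : 0 ≤ q) (h : ∀ f : E → ℂ, HolomorphicOnSubset X f →
    MapsTo f X unitDisc → moebiusDist (f x) (f y) ≤ q) : moebiusFn X x y ≤ q := by
  refine Real.sSup_le ?_ hq
  rintro _ ⟨f, hf, hm, rfl⟩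
  exact h f hf hm

theorem le_moebiusFn (hx : x ∈ X) (hy : y ∈ X) {f : E → ℂ} (hf : HolomorphicOnSubset X f)
    (hm : MapsTo f X unitDisc) : moebiusDist (f x) (f y) ≤ moebiusFn X x y := by
  refine le_csSup ⟨1, ?_⟩ ⟨f, hf, hm, rfl⟩
  rintro _ ⟨g, -, hg, rfl⟩
  exact (moebiusDist_lt_one (mem_unitDisc.mp (hg hx)) (mem_unitDisc.mp (hg hy))).le

end Caratheodory

theorem caratheodoryDist_unitDisc {a b : ℂ} (ha : ‖a‖ < 1) (hb : ‖b‖ < 1) :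
    caratheodoryDist unitDisc a b = poincareDist a b := by
  have : moebiusFn unitDisc a b = moebiusDist a b := by
    refine le_antisymm (moebiusFn_le (moebiusDist_nonneg a b) fun f hf hm => ?_) ?_
    · refine moebiusDist_le_of_mapsTo (fun z hz => ?_) hm ha hb
      obtain ⟨U, F, hU, hzU, hF, hfF⟩ := hf z hz
      refine ((hF z hzU).mono inter_subset_right).congr hfF (hfF z ⟨hz, hzU⟩)
        |>.mono_of_mem_nhdsWithin ?_
      exact inter_mem self_mem_nhdsWithin (mem_nhdsWithin_of_mem_nhds (hU.mem_nhds hzU))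
    · exact le_moebiusFn (f := id) (mem_unitDisc.mpr ha) (mem_unitDisc.mpr hb)
        (fun z _ => ⟨univ, id, isOpen_univ, mem_univ z, differentiableOn_id, fun _ _ => rfl⟩)
        (mapsTo_id _)
  rw [caratheodoryDist, this, poincareDist]

/-! ### Holomorphic functions on the Neil parabola -/

theorem norm_pow_lt_one {m : ℕ} (hm : 1 ≤ m) {t : ℂ} (ht : ‖t‖ < 1) : ‖t ^ m‖ < 1 := by
  rw [norm_pow]; exact pow_lt_one₀ (norm_nonneg t) ht (by omega)

theorem neilParam_mem {m n : ℕ} (hm : 1 ≤ m) (hmn : m ≤ n) {t : ℂ} (ht : ‖t‖ < 1) :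
    neilParam m n t ∈ neilParabola m n :=
  ⟨mem_unitDisc.mpr (norm_pow_lt_one (hm.trans hmn) ht),
    mem_unitDisc.mpr (norm_pow_lt_one hm ht), by
      simp only [neilParam, ← pow_mul, mul_comm]⟩

theorem differentiable_neilParam (m n : ℕ) : Differentiable ℂ (neilParam m n) := by
  unfold neilParam; fun_prop

/-- Up to a disc automorphism, a holomorphic map from the Neil parabola to the disc is of the form
`z ^ m * g z` in the parameter `z`; this is all that the argument needs to know about such maps. -/
theorem exists_moebiusDist_eq {m n : ℕ} (hm : 1 ≤ m) (hmn : m ≤ n) {f : ℂ × ℂ → ℂ}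
    (hf : HolomorphicOnSubset (neilParabola m n) f) (hfm : MapsTo f (neilParabola m n) unitDisc) :
    ∃ g : ℂ → ℂ, DifferentiableOn ℂ g unitDisc ∧ (∀ z ∈ unitDisc, ‖g z‖ ≤ 1) ∧
      ∀ a b : ℂ, ‖a‖ < 1 → ‖b‖ < 1 →
        moebiusDist (f (neilParam m n a)) (f (neilParam m n b)) =
          moebiusDist (a ^ m * g a) (b ^ m * g b) := by
  have ho : IsOpen unitDisc := Metric.isOpen_ball
  have h0 : (0 : ℂ) ∈ unitDisc := mem_unitDisc.mpr (by simp)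
  set h : ℂ → ℂ := fun t => f (neilParam m n t) with hh
  have hmaps : ∀ t : ℂ, ‖t‖ < 1 → ‖h t‖ < 1 := fun t ht =>
    mem_unitDisc.mp (hfm (neilParam_mem hm hmn ht))
  have hlocal : ∀ t : ℂ, ‖t‖ < 1 → ∃ F : ℂ × ℂ → ℂ, DifferentiableAt ℂ F (neilParam m n t) ∧
      h =ᶠ[𝓝 t] fun s => F (neilParam m n s) := by
    intro t ht
    obtain ⟨U, F, hU, htU, hF, hfF⟩ := hf _ (neilParam_mem hm hmn ht)
    refine ⟨F, hF.differentiableAt (hU.mem_nhds htU), ?_⟩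
    filter_upwards [ho.mem_nhds (mem_unitDisc.mpr ht),
      (differentiable_neilParam m n t).continuousAt.preimage_mem_nhds (hU.mem_nhds htU)] with s hs hsU
    exact hfF _ ⟨neilParam_mem hm hmn (mem_unitDisc.mp hs), hsU⟩
  have hhd : DifferentiableOn ℂ h unitDisc := by
    intro t ht
    obtain ⟨F, hF, hhF⟩ := hlocal t (mem_unitDisc.mp ht)
    have : DifferentiableAt ℂ (fun s => F (neilParam m n s)) t :=
      hF.comp t (differentiable_neilParam m n t)
    exact (this.congr_of_eventuallyEq hhF).differentiableWithinAt
  have hc := hmaps 0 (by simp)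
  have hkd : DifferentiableOn ℂ (fun t => discAut (h 0) (h t)) unitDisc :=
    (differentiableOn_discAut hc).comp hhd fun t ht => mem_unitDisc.mpr (hmaps t (mem_unitDisc.mp ht))
  have hO : (fun t => discAut (h 0) (h t)) =O[𝓝 0] fun t : ℂ => t ^ m := by
    obtain ⟨F, hF, hhF⟩ := hlocal 0 (by simp)
    have o1 : (fun t => neilParam m n t - neilParam m n 0) =O[𝓝 0] fun t : ℂ => t ^ m := by
      have e : (fun t => neilParam m n t - neilParam m n 0) = fun t : ℂ => (t ^ n, t ^ m) := by
        ext t <;> simp [neilParam, show n ≠ 0 by omega, show m ≠ 0 by omega]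
      rw [e]
      refine Asymptotics.IsBigO.prod_left ?_ (Asymptotics.isBigO_refl _ _)
      refine Asymptotics.IsBigO.of_bound 1 ?_
      filter_upwards [ho.mem_nhds h0] with t ht
      rw [norm_pow, norm_pow, one_mul]
      exact pow_le_pow_of_le_one (norm_nonneg t) (mem_unitDisc.mp ht).le hmn
    have o2 : (fun t => F (neilParam m n t) - F (neilParam m n 0)) =O[𝓝 0]
        fun t => neilParam m n t - neilParam m n 0 :=
      hF.isBigO_sub.comp_tendsto (differentiable_neilParam m n 0).continuousAt
    have o3 : (fun t => h t - h 0) =O[𝓝 0] fun t : ℂ => t ^ m := by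
      refine (o2.trans o1).congr' ?_ EventuallyEq.rfl
      filter_upwards [hhF] with t ht
      rw [ht, hhF.self_of_nhds]
    have o4 : (fun t => discAut (h 0) (h t) - discAut (h 0) (h 0)) =O[𝓝 0] fun t => h t - h 0 :=
      (hasDerivAt_discAut hc hc).differentiableAt.isBigO_sub.comp_tendsto
        (hhd.differentiableAt (ho.mem_nhds h0)).continuousAt
    simpa [discAut_self] using o4.trans o3
  obtain ⟨g, hgd, hg1, hgk⟩ := exists_eq_pow_mul hm hkd
    (fun t ht => mem_unitDisc.mpr (norm_discAut_lt_one hc (hmaps t (mem_unitDisc.mp ht)))) hO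
  refine ⟨g, hgd, hg1, fun a b ha hb => ?_⟩
  rw [← hgk a (mem_unitDisc.mpr ha), ← hgk b (mem_unitDisc.mpr hb),
    moebiusDist_discAut hc (hmaps a ha) (hmaps b hb)]

theorem norm_pow_mul_lt_one {m : ℕ} (hm : 1 ≤ m) {a u : ℂ} (ha : ‖a‖ < 1) (hu : ‖u‖ ≤ 1) :
    ‖a ^ m * u‖ < 1 := by
  rw [norm_mul]
  nlinarith [norm_pow_lt_one hm ha, norm_nonneg (a ^ m), norm_nonneg u]

theorem caratheodoryDist_neilParam_le {m n : ℕ} (hm : 1 ≤ m) (hmn : m ≤ n) {a b : ℂ} (ha : ‖a‖ < 1)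
    (hb : ‖b‖ < 1) {D : ℝ} (hD : ∀ g : ℂ → ℂ, DifferentiableOn ℂ g unitDisc →
      (∀ z ∈ unitDisc, ‖g z‖ ≤ 1) → poincareDist (a ^ m * g a) (b ^ m * g b) ≤ D) :
    caratheodoryDist (neilParabola m n) (neilParam m n a) (neilParam m n b) ≤ D := by
  have hD0 : 0 ≤ D := (poincareDist_nonneg _ _).trans
    (hD (fun _ => 0) (differentiableOn_const _) (by simp))
  have : moebiusFn (neilParabola m n) (neilParam m n a) (neilParam m n b) ≤ Real.tanh D := by
    refine moebiusFn_le ?_ fun f hf hfm => ?_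
    · rw [← Real.tanh_zero]
      rw [← Real.artanh_le_artanh_iff ⟨Real.neg_one_lt_tanh _, Real.tanh_lt_one _⟩
        ⟨Real.neg_one_lt_tanh _, Real.tanh_lt_one _⟩, Real.artanh_tanh, Real.artanh_tanh]
      exact hD0
    · obtain ⟨g, hgd, hg1, hg⟩ := exists_moebiusDist_eq hm hmn hf hfm
      rw [hg a b ha hb]
      have hlt := moebiusDist_lt_one (norm_pow_mul_lt_one hm ha (hg1 a (mem_unitDisc.mpr ha)))
        (norm_pow_mul_lt_one hm hb (hg1 b (mem_unitDisc.mpr hb)))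
      rw [← Real.artanh_le_artanh_iff ⟨by linarith [moebiusDist_nonneg (a ^ m * g a) (b ^ m * g b)],
        hlt⟩ ⟨Real.neg_one_lt_tanh _, Real.tanh_lt_one _⟩, Real.artanh_tanh]
      exact hD g hgd hg1
  have h1 : 0 ≤ moebiusFn (neilParabola m n) (neilParam m n a) (neilParam m n b) :=
    moebiusFn_nonneg
  have h2 := Real.artanh_le_artanh (by linarith) (Real.tanh_lt_one _) this
  rwa [Real.artanh_tanh] at h2

theorem moebiusFn_neilParam_lt_one {m n : ℕ} (hm : 1 ≤ m) (hmn : m ≤ n) {a b : ℂ} (ha : ‖a‖ < 1)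
    (hb : ‖b‖ < 1) :
    moebiusFn (neilParabola m n) (neilParam m n a) (neilParam m n b) < 1 := by
  refine (moebiusFn_le (moebiusDist_nonneg a b) fun f hf hfm => ?_).trans_lt
    (moebiusDist_lt_one ha hb)
  obtain ⟨g, hgd, hg1, hg⟩ := exists_moebiusDist_eq hm hmn hf hfm
  rw [hg a b ha hb]
  exact moebiusDist_le_of_mapsTo (h := fun z => z ^ m * g z)
    ((differentiableOn_id.pow m).mul hgd)
    (fun z hz => mem_unitDisc.mpr (norm_pow_mul_lt_one hm (mem_unitDisc.mp hz) (hg1 z hz))) ha hb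

/-- The coordinate function `w` shows that `c_A` is at least the pull-back of the Poincaré distance
under `z ^ m`. -/
theorem poincareDist_pow_le_caratheodoryDist {m n : ℕ} (hm : 1 ≤ m) (hmn : m ≤ n) {a b : ℂ}
    (ha : ‖a‖ < 1) (hb : ‖b‖ < 1) :
    poincareDist (a ^ m) (b ^ m) ≤
      caratheodoryDist (neilParabola m n) (neilParam m n a) (neilParam m n b) := by
  refine Real.artanh_le_artanh (by linarith [moebiusDist_nonneg (a ^ m) (b ^ m)])
    (moebiusFn_neilParam_lt_one hm hmn ha hb) ?_
  exact le_moebiusFn (f := Prod.snd) (neilParam_mem hm hmn ha) (neilParam_mem hm hmn hb)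
    (fun z _ => ⟨univ, Prod.snd, isOpen_univ, mem_univ z, differentiableOn_snd, fun _ _ => rfl⟩)
    (fun q hq => hq.2.1)

theorem artanh_norm_pow_mul_le {m : ℕ} (hm : 1 ≤ m) {a u : ℂ} (ha : ‖a‖ < 1) (hu : ‖u‖ ≤ 1) :
    Real.artanh ‖a ^ m * u‖ ≤ Real.artanh (‖a‖ ^ m) := by
  rw [← norm_pow]
  refine Real.artanh_le_artanh (by linarith [norm_nonneg (a ^ m * u)]) (norm_pow_lt_one hm ha) ?_
  rw [norm_mul]
  exact mul_le_of_le_one_right (norm_nonneg _) hu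

theorem caratheodoryDist_neilParam_le_add {m n : ℕ} (hm : 1 ≤ m) (hmn : m ≤ n) {a b : ℂ}
    (ha : ‖a‖ < 1) (hb : ‖b‖ < 1) :
    caratheodoryDist (neilParabola m n) (neilParam m n a) (neilParam m n b) ≤
      Real.artanh (‖a‖ ^ m) + Real.artanh (‖b‖ ^ m) := by
  refine caratheodoryDist_neilParam_le hm hmn ha hb fun g _ hg1 => ?_
  have hga := hg1 a (mem_unitDisc.mpr ha)
  have hgb := hg1 b (mem_unitDisc.mpr hb)
  exact (poincareDist_le_artanh_norm_add (norm_pow_mul_lt_one hm ha hga)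
    (norm_pow_mul_lt_one hm hb hgb)).trans
    (add_le_add (artanh_norm_pow_mul_le hm ha hga) (artanh_norm_pow_mul_le hm hb hgb))

/-- Unless `a ^ m` and `b ^ m` lie on opposite sides of the origin, `c_A` of the corresponding points
is strictly smaller than the sum of their distances to the cusp. The functions `g` that describe the
maps of the Neil parabola to the disc enter only through `(g a, g b)`, which by the Schwarz–Pick
lemma ranges in a compact set, so that an extremal pair exists. -/
theorem caratheodoryDist_neilParam_lt_add {m n : ℕ} (hm : 1 ≤ m) (hmn : m ≤ n) {a b : ℂ}
    (ha : ‖a‖ < 1) (hb : ‖b‖ < 1) (ha0 : a ≠ 0) (hb0 : b ≠ 0)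
    (hneg : ¬ IsNegativeReal ((a * conj b) ^ m)) :
    caratheodoryDist (neilParabola m n) (neilParam m n a) (neilParam m n b) <
      Real.artanh (‖a‖ ^ m) + Real.artanh (‖b‖ ^ m) := by
  set K : Set (ℂ × ℂ) := (Metric.closedBall 0 1 ×ˢ Metric.closedBall 0 1) ∩
    {q | ‖q.1 - q.2‖ ≤ moebiusDist a b * ‖1 - q.1 * conj q.2‖} with hK
  have hKc : IsCompact K := by
    refine ((isCompact_closedBall 0 1).prod (isCompact_closedBall 0 1)).inter_right
      (isClosed_le ?_ ?_)
    · fun_prop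
    · have : Continuous fun q : ℂ × ℂ => conj q.2 := Complex.continuous_conj.comp continuous_snd
      fun_prop
  have hK1 : ∀ q ∈ K, ‖q.1‖ ≤ 1 ∧ ‖q.2‖ ≤ 1 := fun q hq => by simpa using hq.1
  have hcont : ContinuousOn (fun q : ℂ × ℂ => moebiusDist (a ^ m * q.1) (b ^ m * q.2)) K := by
    have : Continuous fun q : ℂ × ℂ => conj (b ^ m * q.2) :=
      Complex.continuous_conj.comp (by fun_prop)
    unfold moebiusDist
    refine (ContinuousOn.div (by fun_prop) (by fun_prop) fun q hq => ?_).norm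
    exact one_sub_mul_conj_ne_zero (norm_pow_mul_lt_one hm ha (hK1 q hq).1)
      (norm_pow_mul_lt_one hm hb (hK1 q hq).2).le
  obtain ⟨⟨u, v⟩, huv, hmax⟩ := hKc.exists_isMaxOn ⟨(0, 0), by simp [hK, moebiusDist_nonneg]⟩ hcont
  obtain ⟨hu, hv⟩ := hK1 _ huv
  dsimp only at hu hv
  have hau := norm_pow_mul_lt_one hm ha hu
  have hbv := norm_pow_mul_lt_one hm hb hv
  have hle : caratheodoryDist (neilParabola m n) (neilParam m n a) (neilParam m n b) ≤
      poincareDist (a ^ m * u) (b ^ m * v) := by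
    refine caratheodoryDist_neilParam_le hm hmn ha hb fun g hgd hg1 => ?_
    refine Real.artanh_le_artanh (by linarith [moebiusDist_nonneg (a ^ m * g a) (b ^ m * g b)])
      (moebiusDist_lt_one hau hbv) ?_
    exact hmax (a := (g a, g b)) ⟨by simp [hg1 a (mem_unitDisc.mpr ha), hg1 b (mem_unitDisc.mpr hb)],
      norm_sub_mul_le_of_mapsTo_closedBall hgd hg1 ha hb⟩
  refine hle.trans_lt ?_
  have hstrict : ∀ c w : ℂ, ‖c‖ < 1 → c ≠ 0 → ‖w‖ < 1 →
      Real.artanh ‖c ^ m * w‖ < Real.artanh (‖c‖ ^ m) := by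
    intro c w hc hc0 hw
    rw [← norm_pow]
    refine Real.artanh_lt_artanh (by linarith [norm_nonneg (c ^ m * w)]) (norm_pow_lt_one hm hc) ?_
    rw [norm_mul]
    exact mul_lt_of_lt_one_right (norm_pos_iff.mpr (pow_ne_zero _ hc0)) hw
  rcases hu.lt_or_eq with hu1 | hu1
  · exact (poincareDist_le_artanh_norm_add hau hbv).trans_lt
      (add_lt_add_of_lt_of_le (hstrict a u ha ha0 hu1) (artanh_norm_pow_mul_le hm hb hv))
  rcases hv.lt_or_eq with hv1 | hv1
  · exact (poincareDist_le_artanh_norm_add hau hbv).trans_lt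
      (add_lt_add_of_le_of_lt (artanh_norm_pow_mul_le hm ha hu) (hstrict b v hb hb0 hv1))
  -- on the torus the constraint defining `K` forces `u = v`
  have huv' : u = v := by
    have h1 := sq_norm_one_sub_mul_conj u v
    rw [hu1, hv1] at h1
    have h2 : ‖1 - u * conj v‖ = ‖u - v‖ := by
      rw [← sq_eq_sq₀ (norm_nonneg _) (norm_nonneg _)]; linarith
    have h3 : ‖u - v‖ ≤ moebiusDist a b * ‖1 - u * conj v‖ := huv.2
    rw [h2] at h3
    have h4 := moebiusDist_lt_one ha hb
    have h5 : ‖u - v‖ = 0 := by nlinarith [norm_nonneg (u - v)]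
    exact sub_eq_zero.mp (norm_eq_zero.mp h5)
  subst huv'
  by_contra! hcon
  refine hneg ?_
  have hna : ‖a ^ m * u‖ = ‖a‖ ^ m := by simp [hu1]
  have hnb : ‖b ^ m * u‖ = ‖b‖ ^ m := by simp [hu1]
  rw [← hna, ← hnb, ← artanh_add (norm_nonneg _) hau (norm_nonneg _) hbv, poincareDist,
    Real.artanh_le_artanh_iff ⟨by
      have : 0 ≤ (‖a ^ m * u‖ + ‖b ^ m * u‖) / (1 + ‖a ^ m * u‖ * ‖b ^ m * u‖) := by positivity
      linarith, add_div_lt_one (norm_nonneg _) hau (norm_nonneg _) hbv⟩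
      ⟨by linarith [moebiusDist_nonneg (a ^ m * u) (b ^ m * u)], moebiusDist_lt_one hau hbv⟩] at hcon
  have h := mul_conj_eq_of_add_div_le_moebiusDist hau hbv hcon
  have huu : u * conj u = 1 := by
    rw [Complex.mul_conj, Complex.normSq_eq_norm_sq, hu1]; simp
  have e : a ^ m * u * conj (b ^ m * u) = (a * conj b) ^ m := by
    rw [map_mul, map_pow, mul_pow]
    linear_combination (a ^ m * conj b ^ m) * huu
  rw [e, hna, hnb] at h
  rw [IsNegativeReal, h]
  have : 0 < ‖a‖ ^ m * ‖b‖ ^ m := by positivity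
  constructor
  · simp only [Complex.neg_im, Complex.ofReal_im, neg_zero]
  · simp only [Complex.neg_re, Complex.ofReal_re]; linarith

/-- Along a curve in the parameter disc, `c_A` is bounded by the hyperbolic length of the image of
the curve under `z ^ m`. -/
theorem caratheodoryDist_le_sub_of_norm_deriv_le {m n : ℕ} (hm : 1 ≤ m) (hmn : m ≤ n)
    {t t' : ℝ → ℂ} {T T' : ℝ → ℝ} {a b : ℝ} (hab : a ≤ b)
    (ht1 : ∀ x ∈ Icc a b, ‖t x‖ < 1) (ht : ∀ x ∈ Icc a b, HasDerivAt t (t' x) x)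
    (hT : ∀ x ∈ Icc a b, HasDerivAt T (T' x) x)
    (hle : ∀ x ∈ Icc a b, m * ‖t x‖ ^ (m - 1) * ‖t' x‖ ≤ (1 - ‖t x ^ m‖ ^ 2) * T' x) :
    caratheodoryDist (neilParabola m n) (neilParam m n (t a)) (neilParam m n (t b)) ≤
      T b - T a := by
  refine caratheodoryDist_neilParam_le hm hmn (ht1 a (left_mem_Icc.mpr hab))
    (ht1 b (right_mem_Icc.mpr hab)) fun g hgd hg1 => ?_
  have ho : IsOpen unitDisc := Metric.isOpen_ball
  set k : ℂ → ℂ := fun z => z ^ m * g z with hk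
  have hkd : DifferentiableOn ℂ k unitDisc := (differentiableOn_id.pow m).mul hgd
  refine poincareDist_le_sub_of_norm_deriv_le (γ := fun x => k (t x))
    (γ' := fun x => deriv k (t x) * t' x) hab
    (fun x hx => norm_pow_mul_lt_one hm (ht1 x hx) (hg1 _ (mem_unitDisc.mpr (ht1 x hx))))
    (fun x hx => ?_) hT fun x hx => ?_
  · exact (hkd.differentiableAt (ho.mem_nhds (mem_unitDisc.mpr (ht1 x hx)))).hasDerivAt.comp x
      (ht x hx)
  · have h1 := norm_deriv_pow_mul_le hm hgd hg1 (ht1 x hx)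
    have h2 := hle x hx
    have hlt := norm_pow_lt_one hm (ht1 x hx)
    have h3 : 0 < 1 - ‖t x ^ m‖ ^ 2 := by nlinarith [norm_nonneg (t x ^ m)]
    have hk1 := norm_pow_mul_lt_one hm (ht1 x hx) (hg1 _ (mem_unitDisc.mpr (ht1 x hx)))
    have h4 : 0 ≤ 1 - ‖t x ^ m * g (t x)‖ ^ 2 := by nlinarith [norm_nonneg (t x ^ m * g (t x))]
    rw [norm_mul]
    refine le_of_mul_le_mul_right ?_ h3
    calc ‖deriv k (t x)‖ * ‖t' x‖ * (1 - ‖t x ^ m‖ ^ 2)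
        = ‖deriv k (t x)‖ * (1 - ‖t x ^ m‖ ^ 2) * ‖t' x‖ := by ring
      _ ≤ (1 - ‖t x ^ m * g (t x)‖ ^ 2) * (m * ‖t x‖ ^ (m - 1)) * ‖t' x‖ := by gcongr
      _ = (1 - ‖t x ^ m * g (t x)‖ ^ 2) * (m * ‖t x‖ ^ (m - 1) * ‖t' x‖) := by ring
      _ ≤ (1 - ‖t x ^ m * g (t x)‖ ^ 2) * ((1 - ‖t x ^ m‖ ^ 2) * T' x) := by gcongr
      _ = _ := by ring

/-! ### Carathéodory length -/

section Length

variable {E : Type*} [NormedAddCommGroup E] [NormedSpace ℂ E] {X : Set E} {α : ℝ → E}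

theorem caratheodoryDist_comm (x y : E) : caratheodoryDist X x y = caratheodoryDist X y x := by
  simp only [caratheodoryDist, moebiusFn, moebiusDist_comm]

theorem caratheodoryLength_le {T : ℝ → ℝ} (h : ∀ x ∈ Icc (0 : ℝ) 1, ∀ y ∈ Icc (0 : ℝ) 1, x ≤ y →
    caratheodoryDist X (α x) (α y) ≤ T y - T x) :
    caratheodoryLength X α ≤ ENNReal.ofReal (T 1 - T 0) := by
  have hmono : MonotoneOn T (Icc 0 1) := fun x hx y hy hxy => by
    linarith [h x hx y hy hxy, caratheodoryDist_nonneg (X := X) (x := α x) (y := α y)]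
  refine iSup_le ?_
  rintro ⟨k, u, hu, hu1⟩
  dsimp only
  rw [← ENNReal.ofReal_sum_of_nonneg fun i _ => caratheodoryDist_nonneg]
  refine ENNReal.ofReal_le_ofReal ?_
  calc ∑ i ∈ Finset.range k, caratheodoryDist X (α (u i)) (α (u (i + 1)))
      ≤ ∑ i ∈ Finset.range k, (T (u (i + 1)) - T (u i)) :=
        Finset.sum_le_sum fun i _ => h _ (hu1 _) _ (hu1 _) (hu (Nat.le_succ i))
    _ = T (u k) - T (u 0) := Finset.sum_range_sub (fun i => T (u i)) k
    _ ≤ T 1 - T 0 := sub_le_sub (hmono (hu1 k) (by simp) (hu1 k).2)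
        (hmono (by simp) (hu1 0) (hu1 0).1)

theorem ofReal_add_le_caratheodoryLength {s : ℝ} (hs : s ∈ Icc (0 : ℝ) 1) :
    ENNReal.ofReal (caratheodoryDist X (α 0) (α s)) +
      ENNReal.ofReal (caratheodoryDist X (α s) (α 1)) ≤ caratheodoryLength X α := by
  set u : ℕ → ℝ := fun i => if i = 0 then 0 else if i = 1 then s else 1 with hu
  have hu1 : ∀ i, u i ∈ Icc (0 : ℝ) 1 := by
    intro i
    simp only [hu]
    split_ifs <;> simp [hs.1, hs.2]
  have hmono : Monotone u := by
    refine monotone_nat_of_le_succ fun i => ?_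
    rcases i with _ | _ | i
    · simpa [hu] using hs.1
    · simpa [hu] using hs.2
    · simp [hu]
  refine le_trans (le_of_eq ?_) (le_iSup _ ((2, ⟨u, hmono, hu1⟩) :
    ℕ × {u : ℕ → ℝ // Monotone u ∧ ∀ i, u i ∈ Icc (0 : ℝ) 1}))
  simp [Finset.sum_range_succ, hu]

theorem ofReal_caratheodoryDist_le_length :
    ENNReal.ofReal (caratheodoryDist X (α 0) (α 1)) ≤ caratheodoryLength X α := by
  set u : ℕ → ℝ := fun i => if i = 0 then 0 else 1 with hu
  have hu1 : ∀ i, u i ∈ Icc (0 : ℝ) 1 := by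
    intro i
    simp only [hu]
    split_ifs <;> simp
  have hmono : Monotone u := by
    refine monotone_nat_of_le_succ fun i => ?_
    rcases i with _ | i <;> simp [hu]
  refine le_trans (le_of_eq ?_) (le_iSup _ ((1, ⟨u, hmono, hu1⟩) :
    ℕ × {u : ℕ → ℝ // Monotone u ∧ ∀ i, u i ∈ Icc (0 : ℝ) 1}))
  simp [hu]

theorem ofReal_caratheodoryDist_le_inner (x y : E) :
    ENNReal.ofReal (caratheodoryDist X x y) ≤ innerCaratheodoryDist X x y := by
  refine le_iInf₂ ?_
  rintro α ⟨-, -, -, rfl, rfl⟩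
  exact ofReal_caratheodoryDist_le_length

end Length

theorem isRectifiableCurve_neilParam {m n : ℕ} (hm : 1 ≤ m) (hmn : m ≤ n) {t : ℝ → ℂ}
    (ht1 : ∀ x ∈ Icc (0 : ℝ) 1, ‖t x‖ < 1) {K : NNReal} (ht : LipschitzOnWith K t (Icc 0 1)) :
    IsRectifiableCurve (neilParabola m n) (neilParam m n (t 0)) (neilParam m n (t 1))
      (fun x => neilParam m n (t x)) := by
  have hp : ContDiffOn ℝ 1 (neilParam m n) (Metric.closedBall 0 1) := by
    unfold neilParam; fun_prop
  obtain ⟨C, hC⟩ := hp.exists_lipschitzOnWith one_ne_zero (convex_closedBall 0 1)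
    (isCompact_closedBall 0 1)
  have hL := hC.comp ht fun x hx => by simpa using (ht1 x hx).le
  refine ⟨hL.continuousOn, fun x hx => neilParam_mem hm hmn (ht1 x hx), ?_, rfl, rfl⟩
  have := hL.locallyBoundedVariationOn 0 1 (by simp) (by simp)
  rwa [inter_self] at this

theorem innerCaratheodoryDist_neilParam_le {m n : ℕ} (hm : 1 ≤ m) (hmn : m ≤ n) {t : ℝ → ℂ}
    (ht1 : ∀ x ∈ Icc (0 : ℝ) 1, ‖t x‖ < 1) {K : NNReal} (ht : LipschitzOnWith K t (Icc 0 1))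
    {T : ℝ → ℝ} (h : ∀ x ∈ Icc (0 : ℝ) 1, ∀ y ∈ Icc (0 : ℝ) 1, x ≤ y →
      caratheodoryDist (neilParabola m n) (neilParam m n (t x)) (neilParam m n (t y)) ≤ T y - T x) :
    innerCaratheodoryDist (neilParabola m n) (neilParam m n (t 0)) (neilParam m n (t 1)) ≤
      ENNReal.ofReal (T 1 - T 0) :=
  (iInf₂_le _ (isRectifiableCurve_neilParam hm hmn ht1 ht)).trans (caratheodoryLength_le h)

/-! ### Curves through the cusp -/

theorem caratheodoryDist_radial_le {m n : ℕ} (hm : 1 ≤ m) (hmn : m ≤ n) {c : ℂ} (hc : ‖c‖ < 1)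
    {x y : ℝ} (hx : 0 ≤ x) (hxy : x ≤ y) (hy : y ≤ 1) :
    caratheodoryDist (neilParabola m n) (neilParam m n (x * c)) (neilParam m n (y * c)) ≤
      Real.artanh ((y * ‖c‖) ^ m) - Real.artanh ((x * ‖c‖) ^ m) := by
  have hlt : ∀ z ∈ Icc x y, 0 ≤ z * ‖c‖ ∧ z * ‖c‖ < 1 := fun z hz => by
    have h0 : 0 ≤ z := hx.trans hz.1
    have h1 : z ≤ 1 := hz.2.trans hy
    exact ⟨by positivity, by nlinarith [norm_nonneg c]⟩
  have hn : ∀ z ∈ Icc x y, ‖(z : ℂ) * c‖ = z * ‖c‖ := fun z hz => by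
    rw [norm_mul, Complex.norm_real, Real.norm_of_nonneg (hx.trans hz.1)]
  have hpow : ∀ z ∈ Icc x y, (z * ‖c‖) ^ m < 1 := fun z hz =>
    pow_lt_one₀ (hlt z hz).1 (hlt z hz).2 (by omega)
  refine caratheodoryDist_le_sub_of_norm_deriv_le (t := fun z => (z : ℂ) * c) (t' := fun _ => c)
    (T := fun z => Real.artanh ((z * ‖c‖) ^ m))
    (T' := fun z => 1 / (1 - ((z * ‖c‖) ^ m) ^ 2) * (m * (z * ‖c‖) ^ (m - 1) * ‖c‖)) hm hmn hxy
    (fun z hz => (hn z hz).trans_lt (hlt z hz).2) (fun z _ => ?_) (fun z hz => ?_) fun z hz => ?_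
  · simpa using ((hasDerivAt_id z).ofReal_comp).mul_const c
  · have h1 : HasDerivAt (fun z : ℝ => (z * ‖c‖) ^ m) (m * (z * ‖c‖) ^ (m - 1) * ‖c‖) z := by
      simpa using! ((hasDerivAt_id z).mul_const ‖c‖).pow m
    exact hasDerivAt_artanh_comp h1 (by linarith [pow_nonneg (hlt z hz).1 m]) (hpow z hz)
  · have h1 : 1 - ((z * ‖c‖) ^ m) ^ 2 ≠ 0 := by
      have := hpow z hz
      have := pow_nonneg (hlt z hz).1 m
      nlinarith
    rw [norm_pow, hn z hz]
    field_simp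
    exact le_rfl

/-- The right-hand side is the length of the curve that consists of the images of the two radii from
`a` to `0` and from `0` to `b`. -/
theorem innerCaratheodoryDist_le_add {m n : ℕ} (hm : 1 ≤ m) (hmn : m ≤ n) {a b : ℂ}
    (ha : ‖a‖ < 1) (hb : ‖b‖ < 1) :
    innerCaratheodoryDist (neilParabola m n) (neilParam m n a) (neilParam m n b) ≤
      ENNReal.ofReal (Real.artanh (‖a‖ ^ m) + Real.artanh (‖b‖ ^ m)) := by
  have hm0 : m ≠ 0 := by omega
  set t : ℝ → ℂ := fun x => (max (1 - 2 * x) 0 : ℝ) * a + (max (2 * x - 1) 0 : ℝ) * b with ht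
  set T : ℝ → ℝ := fun x => Real.artanh ((max (2 * x - 1) 0 * ‖b‖) ^ m) -
    Real.artanh ((max (1 - 2 * x) 0 * ‖a‖) ^ m) with hT
  have tl : ∀ x : ℝ, x ≤ 1 / 2 → t x = ((1 - 2 * x : ℝ) : ℂ) * a := fun x hx => by
    simp only [ht]
    rw [max_eq_left (by linarith), max_eq_right (by linarith)]; simp
  have tr : ∀ x : ℝ, 1 / 2 ≤ x → t x = ((2 * x - 1 : ℝ) : ℂ) * b := fun x hx => by
    simp only [ht]
    rw [max_eq_right (by linarith), max_eq_left (by linarith)]; simp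
  have Tl : ∀ x : ℝ, x ≤ 1 / 2 → T x = -Real.artanh (((1 - 2 * x) * ‖a‖) ^ m) := fun x hx => by
    simp only [hT]
    rw [max_eq_right (by linarith), max_eq_left (by linarith)]; simp [hm0]
  have Tr : ∀ x : ℝ, 1 / 2 ≤ x → T x = Real.artanh (((2 * x - 1) * ‖b‖) ^ m) := fun x hx => by
    simp only [hT]
    rw [max_eq_left (by linarith), max_eq_right (by linarith)]; simp [hm0]
  have nl : ∀ x : ℝ, x ≤ 1 / 2 → ‖t x‖ = (1 - 2 * x) * ‖a‖ := fun x hx => by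
    rw [tl x hx, norm_mul, Complex.norm_real, Real.norm_of_nonneg (by linarith)]
  have nr : ∀ x : ℝ, 1 / 2 ≤ x → ‖t x‖ = (2 * x - 1) * ‖b‖ := fun x hx => by
    rw [tr x hx, norm_mul, Complex.norm_real, Real.norm_of_nonneg (by linarith)]
  have ht1 : ∀ x ∈ Icc (0 : ℝ) 1, ‖t x‖ < 1 := by
    intro x hx
    rcases le_total x (1 / 2) with h | h
    · rw [nl x h]; nlinarith [norm_nonneg a, hx.1]
    · rw [nr x h]; nlinarith [norm_nonneg b, hx.2]
  have hLip : LipschitzOnWith 4 t (Icc 0 1) := by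
    refine LipschitzOnWith.of_dist_le_mul fun x _ y _ => ?_
    have e : t x - t y = ((max (1 - 2 * x) 0 - max (1 - 2 * y) 0 : ℝ) : ℂ) * a +
        ((max (2 * x - 1) 0 - max (2 * y - 1) 0 : ℝ) : ℂ) * b := by
      simp only [ht]; push_cast; ring
    have h1 : |max (1 - 2 * x) 0 - max (1 - 2 * y) 0| ≤ 2 * |x - y| := by
      refine (abs_max_sub_max_le_abs _ _ _).trans_eq ?_
      rw [show 1 - 2 * x - (1 - 2 * y) = -(2 * (x - y)) by ring, abs_neg, abs_mul, abs_two]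
    have h2 : |max (2 * x - 1) 0 - max (2 * y - 1) 0| ≤ 2 * |x - y| := by
      refine (abs_max_sub_max_le_abs _ _ _).trans_eq ?_
      rw [show 2 * x - 1 - (2 * y - 1) = 2 * (x - y) by ring, abs_mul, abs_two]
    rw [dist_eq_norm, e, Real.dist_eq]
    refine (norm_add_le _ _).trans ?_
    rw [norm_mul, norm_mul, Complex.norm_real, Complex.norm_real, Real.norm_eq_abs,
      Real.norm_eq_abs]
    have h3 := mul_le_mul h1 ha.le (norm_nonneg a) (by positivity)
    have h4 := mul_le_mul h2 hb.le (norm_nonneg b) (by positivity)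
    norm_num
    linarith
  have key := innerCaratheodoryDist_neilParam_le hm hmn ht1 hLip (T := T) ?_
  · have e0 : t 0 = a := by rw [tl 0 (by norm_num)]; simp
    have e1 : t 1 = b := by rw [tr 1 (by norm_num)]; norm_num
    have E0 : T 0 = -Real.artanh (‖a‖ ^ m) := by rw [Tl 0 (by norm_num)]; simp
    have E1 : T 1 = Real.artanh (‖b‖ ^ m) := by rw [Tr 1 (by norm_num)]; norm_num
    rw [e0, e1, E0, E1] at key
    convert key using 2
    ring
  · intro x hx y hy hxy
    rcases le_total y (1 / 2) with h | h
    · have hx2 := hxy.trans h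
      rw [caratheodoryDist_comm, tl x hx2, tl y h, Tl x hx2, Tl y h]
      have := caratheodoryDist_radial_le hm hmn ha (x := 1 - 2 * y) (y := 1 - 2 * x)
        (by linarith) (by linarith) (by linarith [hx.1])
      linarith
    rcases le_total x (1 / 2) with h' | h'
    · have := caratheodoryDist_neilParam_le_add hm hmn (ht1 x hx) (ht1 y hy)
      rw [nl x h', nr y h] at this
      rw [Tl x h', Tr y h]
      linarith
    · rw [tr x h', tr y h, Tr x h', Tr y h]
      exact caratheodoryDist_radial_le hm hmn hb (by linarith) (by linarith) (by linarith [hy.2])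

/-! ### Lifted geodesics -/

/-- The geodesic of the disc from `A` to `A * β` meets the ray from `0` through `-A` only if `β` is
real and nonpositive. -/
theorem geodesic_div_mem_slitPlane {A β : ℂ} (hA : ‖A‖ < 1) (hB : ‖A * β‖ < 1) (hA0 : A ≠ 0)
    (hβ : β ∈ Complex.slitPlane) {x : ℝ} (hx : x ∈ Icc (0 : ℝ) 1) :
    discAut (-A) (x * discAut A (A * β)) / A ∈ Complex.slitPlane := by
  set ρ := ‖A‖ ^ 2 with hρ
  have hρ0 : 0 ≤ ρ := by positivity
  have hρ1 : ρ < 1 := by nlinarith [norm_nonneg A]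
  have hAA : A * conj A = (ρ : ℂ) := by
    rw [Complex.mul_conj, Complex.normSq_eq_norm_sq]
  have e1 : 1 - A * β * conj A = 1 - β * ρ := by rw [← hAA]; ring
  have hD1 : 1 - β * ρ ≠ 0 := by
    rw [← e1]; exact one_sub_mul_conj_ne_zero hB hA.le
  have hC : discAut A (A * β) = A * (β - 1) / (1 - β * ρ) := by
    rw [discAut, e1]; congr 1; ring
  have hxC : ‖x * discAut A (A * β)‖ < 1 := by
    rw [norm_mul, Complex.norm_real, Real.norm_of_nonneg hx.1]
    nlinarith [norm_discAut_lt_one hA hB, norm_nonneg (discAut A (A * β)), hx.2, hx.1]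
  have hden := one_sub_mul_conj_ne_zero (b := -A) hxC (by simpa using hA.le)
  have e2 : 1 - x * discAut A (A * β) * conj (-A)
      = ((1 - x * ρ) - β * ρ * (1 - x)) / (1 - β * ρ) := by
    rw [hC, map_neg, eq_div_iff hD1]
    have : (1 - ↑x * (A * (β - 1) / (1 - β * ↑ρ)) * -conj A) * (1 - β * ↑ρ)
        = (1 - β * ρ) + x * (β - 1) * (A * conj A) * ((1 - β * ρ) / (1 - β * ρ)) := by ring
    rw [this, div_self hD1, hAA]; ring
  have hDn : (1 - x * ρ) - β * ρ * (1 - x) ≠ 0 := by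
    intro h; rw [e2, h, zero_div] at hden; exact hden rfl
  have e3 : x * discAut A (A * β) - -A = A * ((1 - x) + β * (x - ρ)) / (1 - β * ρ) := by
    rw [hC, eq_div_iff hD1, sub_mul, mul_assoc, div_mul_cancel₀ _ hD1]; ring
  have hq : discAut (-A) (x * discAut A (A * β)) / A
      = ((1 - x) + β * (x - ρ)) / ((1 - x * ρ) - β * ρ * (1 - x)) := by
    rw [discAut, e2, e3, div_div_div_cancel_right₀ hD1, div_div, mul_comm _ A,
      mul_div_mul_left _ _ hA0]
  rw [hq]
  have hNp : 0 < Complex.normSq ((1 - x * ρ) - β * ρ * (1 - x) : ℂ) := Complex.normSq_pos.mpr hDn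
  rw [Complex.mem_slitPlane_iff]
  by_cases hβi : β.im = 0
  · -- `β` is positive, and both the numerator and the denominator are positive reals
    left
    have hβr : 0 < β.re := by
      rcases Complex.mem_slitPlane_iff.mp hβ with h | h
      · exact h
      · exact absurd hβi h
    have hβe : β = (β.re : ℂ) := Complex.ext rfl (by simp [hβi])
    have hβρ : β.re * ρ < 1 := by
      rw [hβe, norm_mul, Complex.norm_real, Real.norm_of_nonneg hβr.le] at hB
      rw [hρ]; nlinarith [norm_nonneg A, mul_nonneg (norm_nonneg A) hβr.le]
    rw [hβe]
    have e4 : ((1 - x) + β.re * (x - ρ)) / ((1 - x * ρ) - β.re * ρ * (1 - x))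
        = ((((1 - x) + β.re * (x - ρ)) / ((1 - x * ρ) - β.re * ρ * (1 - x)) : ℝ) : ℂ) := by
      push_cast; rfl
    rw [e4, Complex.ofReal_re]
    have hx1 : 0 ≤ 1 - x := by linarith [hx.2]
    have hpos : ∀ c : ℝ, 0 < c → 0 < (1 - x) * (1 - β.re * ρ) + x * c * (1 - ρ) := by
      intro c hc
      rcases hx.1.eq_or_lt with h | h
      · rw [← h]; linarith
      · have h5 : 0 < x * c * (1 - ρ) := mul_pos (mul_pos h hc) (by linarith)
        have h6 : 0 ≤ (1 - x) * (1 - β.re * ρ) := mul_nonneg hx1 (by linarith)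
        linarith
    refine div_pos ?_ ?_
    · have := hpos β.re hβr; linarith
    · have := hpos 1 one_pos; linarith
  · rcases hx.1.eq_or_lt with h | h
    · left
      rw [← h] at hDn ⊢
      have e5 : ((1 - ((0 : ℝ) : ℂ)) + β * (((0 : ℝ) : ℂ) - ρ)) /
          ((1 - ((0 : ℝ) : ℂ) * ρ) - β * ρ * (1 - ((0 : ℝ) : ℂ))) = 1 := by
        rw [div_eq_one_iff_eq hDn]; push_cast; ring
      rw [e5]; simp
    · right
      rw [Complex.div_im, ← sub_div]
      refine div_ne_zero ?_ hNp.ne'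
      have : x * (1 - ρ) ^ 2 * β.im ≠ 0 :=
        mul_ne_zero (mul_ne_zero h.ne' (pow_ne_zero _ (by linarith))) hβi
      convert this using 1
      simp
      ring

/-- If the angle between `a` and `b = a * w` is less than `π / m`, the geodesic from `a ^ m` to
`b ^ m` lifts to a curve from `a` to `b`, whose Carathéodory length is the Poincaré distance of
`a ^ m` and `b ^ m`. -/
theorem innerCaratheodoryDist_le_poincareDist {m n : ℕ} (hm : 1 ≤ m) (hmn : m ≤ n) {a w : ℂ}
    (ha : ‖a‖ < 1) (hb : ‖a * w‖ < 1) (ha0 : a ≠ 0) (hw : w ^ m ∈ Complex.slitPlane)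
    (hlt : -(Real.pi / m) < w.arg) (hle : w.arg ≤ Real.pi / m) :
    innerCaratheodoryDist (neilParabola m n) (neilParam m n a) (neilParam m n (a * w)) ≤
      ENNReal.ofReal (poincareDist (a ^ m) ((a * w) ^ m)) := by
  have hm0 : m ≠ 0 := by omega
  have hmC : (m : ℂ) ≠ 0 := Nat.cast_ne_zero.mpr hm0
  set A := a ^ m with hAdef
  have hA : ‖A‖ < 1 := norm_pow_lt_one hm ha
  have hnA : ‖-A‖ < 1 := by simpa
  have hA0 : A ≠ 0 := pow_ne_zero _ ha0
  have hB : ‖A * w ^ m‖ < 1 := by rw [hAdef, ← mul_pow]; exact norm_pow_lt_one hm hb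
  set C := discAut A (A * w ^ m) with hCdef
  have hC : ‖C‖ < 1 := norm_discAut_lt_one hA hB
  have hxC : ∀ x ∈ Icc (0 : ℝ) 1, ‖(x : ℂ) * C‖ = x * ‖C‖ ∧ x * ‖C‖ < 1 := fun x hx => by
    rw [norm_mul, Complex.norm_real, Real.norm_of_nonneg hx.1]
    exact ⟨rfl, by nlinarith [norm_nonneg C, hx.1, hx.2]⟩
  have hxC1 : ∀ x ∈ Icc (0 : ℝ) 1, ‖(x : ℂ) * C‖ < 1 := fun x hx =>
    (hxC x hx).1.trans_lt (hxC x hx).2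
  set G : ℝ → ℂ := fun x => discAut (-A) (x * C) with hG
  set G' : ℝ → ℂ := fun x => ((1 - ‖-A‖ ^ 2 : ℝ) : ℂ) / (1 - x * C * conj (-A)) ^ 2 * C with hG'
  set q : ℝ → ℂ := fun x => G x / A with hq
  set t : ℝ → ℂ := fun x => a * Complex.exp (Complex.log (q x) / m) with ht
  have hqs : ∀ x ∈ Icc (0 : ℝ) 1, q x ∈ Complex.slitPlane := fun x hx =>
    geodesic_div_mem_slitPlane hA hB hA0 hw hx
  have hq0 : ∀ x ∈ Icc (0 : ℝ) 1, q x ≠ 0 := fun x hx => Complex.slitPlane_ne_zero (hqs x hx)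
  have hGd : ∀ x ∈ Icc (0 : ℝ) 1, HasDerivAt G (G' x) x := fun x hx => by
    have h1 : HasDerivAt (fun x : ℝ => (x : ℂ) * C) C x := by
      simpa using ((hasDerivAt_id x).ofReal_comp).mul_const C
    exact (hasDerivAt_discAut hnA (hxC1 x hx)).comp x h1
  have htm : ∀ x ∈ Icc (0 : ℝ) 1, t x ^ m = G x := fun x hx => by
    simp only [ht]
    rw [mul_pow, ← Complex.exp_nat_mul, mul_div_cancel₀ _ hmC, Complex.exp_log (hq0 x hx)]
    simp only [hq, ← hAdef]
    field_simp
  have hG1 : ∀ x ∈ Icc (0 : ℝ) 1, ‖G x‖ < 1 := fun x hx => norm_discAut_lt_one hnA (hxC1 x hx)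
  have ht1 : ∀ x ∈ Icc (0 : ℝ) 1, ‖t x‖ < 1 := fun x hx => by
    have h1 := hG1 x hx
    rw [← htm x hx, norm_pow] at h1
    exact (pow_lt_one_iff_of_nonneg (norm_nonneg _) hm0).mp h1
  have hpos1 : ∀ x ∈ Icc (0 : ℝ) 1, 1 - (x * ‖C‖) ^ 2 ≠ 0 := fun x hx => by
    have h0 : 0 ≤ x * ‖C‖ := mul_nonneg hx.1 (norm_nonneg C)
    nlinarith [(hxC x hx).2]
  -- `G` has constant hyperbolic speed in terms of `artanh (x * ‖C‖)`
  have hspeed : ∀ x ∈ Icc (0 : ℝ) 1,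
      ‖G' x‖ = (1 - ‖G x‖ ^ 2) * (1 / (1 - (x * ‖C‖) ^ 2) * ‖C‖) := fun x hx => by
    have h1 := sq_moebiusDist (hxC1 x hx) hnA.le
    have h2 : ‖1 - (x : ℂ) * C * conj (-A)‖ ≠ 0 :=
      norm_ne_zero_iff.mpr (one_sub_mul_conj_ne_zero (hxC1 x hx) hnA.le)
    have h3 := hpos1 x hx
    have h4 : 0 ≤ 1 - ‖-A‖ ^ 2 := by nlinarith [norm_nonneg (-A)]
    simp only [hG, hG']
    rw [norm_discAut, h1, norm_mul, norm_div, norm_pow, Complex.norm_real,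
      Real.norm_of_nonneg h4, (hxC x hx).1]
    generalize ‖1 - (x : ℂ) * C * conj (-A)‖ = y at *
    generalize 1 - (x * ‖C‖) ^ 2 = u at *
    field_simp
    ring
  set t' : ℝ → ℂ := fun x => t x * (G' x / G x / m) with ht'
  have htd : ∀ x ∈ Icc (0 : ℝ) 1, HasDerivAt t (t' x) x := fun x hx => by
    have h1 := (((((hGd x hx).div_const A).clog_real (hqs x hx)).div_const (m : ℂ)).cexp).const_mul a
    refine h1.congr_deriv ?_
    have h2 : G' x / A / q x = G' x / G x := by
      simp only [hq]; field_simp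
    simp only [ht', ht]
    rw [mul_assoc]
    congr 2
    rw [← h2]
  have hLip : ∃ K, LipschitzOnWith K t (Icc 0 1) := by
    refine ContDiffOn.exists_lipschitzOnWith (n := 1) (fun x hx => ?_) one_ne_zero
      (convex_Icc 0 1) isCompact_Icc
    have h1 : ContDiffAt ℝ 1 q x := by
      have h0 := one_sub_mul_conj_ne_zero (hxC1 x hx) hnA.le
      have h2 : ContDiff ℝ 1 (fun x : ℝ => (x : ℂ) * C) :=
        Complex.ofRealCLM.contDiff.mul contDiff_const
      have h4 : ContDiffAt ℝ 1 (fun x : ℝ => (x : ℂ) * C - -A) x :=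
        (h2.sub contDiff_const).contDiffAt
      have h5 : ContDiffAt ℝ 1 (fun x : ℝ => 1 - (x : ℂ) * C * conj (-A)) x :=
        (contDiff_const.sub (h2.mul contDiff_const)).contDiffAt
      have h6 : q = fun x : ℝ => ((x : ℂ) * C - -A) * (1 - (x : ℂ) * C * conj (-A))⁻¹ * A⁻¹ := by
        funext y; simp only [hq, hG, discAut, div_eq_mul_inv]
      rw [h6]
      exact (h4.mul (h5.inv h0)).mul contDiffAt_const
    have h3 : ContDiffAt ℝ 1 (fun x => Complex.log (q x)) x :=
      ((Complex.contDiffAt_log (hqs x hx)).restrict_scalars ℝ).comp x h1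
    exact (contDiffAt_const.mul (h3.div_const (m : ℂ)).cexp).contDiffWithinAt
  obtain ⟨K, hK⟩ := hLip
  have hsub : ∀ x ∈ Icc (0 : ℝ) 1, ∀ y ∈ Icc (0 : ℝ) 1, x ≤ y →
      caratheodoryDist (neilParabola m n) (neilParam m n (t x)) (neilParam m n (t y)) ≤
        Real.artanh (y * ‖C‖) - Real.artanh (x * ‖C‖) := by
    intro x hx y hy hxy
    have hI : ∀ z ∈ Icc x y, z ∈ Icc (0 : ℝ) 1 := fun z hz => ⟨hx.1.trans hz.1, hz.2.trans hy.2⟩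
    refine caratheodoryDist_le_sub_of_norm_deriv_le (t' := t')
      (T := fun z => Real.artanh (z * ‖C‖)) (T' := fun z => 1 / (1 - (z * ‖C‖) ^ 2) * ‖C‖) hm hmn hxy
      (fun z hz => ht1 z (hI z hz)) (fun z hz => htd z (hI z hz)) (fun z hz => ?_) fun z hz => ?_
    · have h1 : HasDerivAt (fun z : ℝ => z * ‖C‖) ‖C‖ z := by
        simpa using (hasDerivAt_id z).mul_const ‖C‖
      have h0 : 0 ≤ z * ‖C‖ := mul_nonneg (hI z hz).1 (norm_nonneg C)
      exact hasDerivAt_artanh_comp h1 (by linarith) (hxC z (hI z hz)).2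
    · have hz' := hI z hz
      rw [htm z hz', ← hspeed z hz']
      have hGn : ‖t z‖ ^ m = ‖G z‖ := by rw [← htm z hz', norm_pow]
      have hG0 : ‖G z‖ ≠ 0 := by
        rw [norm_ne_zero_iff]
        intro h
        exact hq0 z hz' (by simp [hq, h])
      have hmR : (m : ℝ) ≠ 0 := Nat.cast_ne_zero.mpr hm0
      have e : ‖t z‖ ^ (m - 1) * ‖t z‖ = ‖G z‖ := by
        rw [← pow_succ, Nat.sub_add_cancel hm, hGn]
      simp only [ht', norm_mul, norm_div, RCLike.norm_natCast]
      refine le_of_eq ?_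
      calc (m : ℝ) * ‖t z‖ ^ (m - 1) * (‖t z‖ * (‖G' z‖ / ‖G z‖ / m))
          = ‖t z‖ ^ (m - 1) * ‖t z‖ * (m * (‖G' z‖ / ‖G z‖ / m)) := by ring
        _ = ‖G' z‖ := by rw [e]; field_simp
  have key := innerCaratheodoryDist_neilParam_le hm hmn ht1 hK
    (T := fun z => Real.artanh (z * ‖C‖)) hsub
  have e0 : t 0 = a := by
    simp only [ht, hq, hG]
    rw [Complex.ofReal_zero, zero_mul, discAut_neg_zero, div_self hA0]
    simp
  have e1 : t 1 = a * w := by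
    have hw0 : w ^ m ≠ 0 := Complex.slitPlane_ne_zero hw
    have h1 : q 1 = w ^ m := by
      simp only [hq, hG, hCdef]
      rw [Complex.ofReal_one, one_mul, discAut_neg_discAut hA hB]
      field_simp
    have h2 := Complex.pow_cpow_nat_inv hm0 hlt hle
    rw [Complex.cpow_def_of_ne_zero hw0, ← div_eq_mul_inv] at h2
    simp only [ht]
    rw [h1, h2]
  rw [e0, e1] at key
  simpa [hCdef, norm_discAut, poincareDist, moebiusDist_comm, hAdef, mul_pow] using key

/-! ### The parametrization is a homeomorphism -/

theorem neilParam_injective {m n : ℕ} (hm : 1 ≤ m) (hcop : Nat.Coprime m n) :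
    Function.Injective (neilParam m n) := by
  intro s t hst
  obtain ⟨hn, hm'⟩ := Prod.mk.inj hst
  rcases eq_or_ne t 0 with rfl | ht
  · rw [zero_pow (by omega)] at hm'
    exact pow_eq_zero_iff (by omega) |>.mp hm'
  · have h1 : (s / t) ^ m = 1 := by rw [div_pow, hm', div_self (pow_ne_zero _ ht)]
    have h2 : (s / t) ^ n = 1 := by rw [div_pow, hn, div_self (pow_ne_zero _ ht)]
    have h3 : orderOf (s / t) ∣ 1 := by
      rw [← hcop.gcd_eq_one]
      exact Nat.dvd_gcd (orderOf_dvd_of_pow_eq_one h1) (orderOf_dvd_of_pow_eq_one h2)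
    rw [Nat.dvd_one, orderOf_eq_one_iff] at h3
    exact (div_eq_one_iff_eq ht).mp h3

theorem exists_neilParam_eq {m n : ℕ} (hm : 1 ≤ m) (hcop : Nat.Coprime m n) {q : ℂ × ℂ}
    (hq : q ∈ neilParabola m n) : ∃ t : ℂ, ‖t‖ < 1 ∧ neilParam m n t = q := by
  obtain ⟨hz, hw, he⟩ := hq
  have hm0 : m ≠ 0 := by omega
  suffices h : ∃ t : ℂ, neilParam m n t = q by
    obtain ⟨t, rfl⟩ := h
    refine ⟨t, ?_, rfl⟩
    have : ‖t ^ m‖ < 1 := mem_unitDisc.mp hw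
    rw [norm_pow] at this
    exact (pow_lt_one_iff_of_nonneg (norm_nonneg t) hm0).mp this
  obtain ⟨s, hs⟩ := IsAlgClosed.exists_pow_nat_eq q.2 (show 0 < m by omega)
  rcases eq_or_ne s 0 with rfl | hs0
  · have hw0 : q.2 = 0 := by rw [← hs, zero_pow hm0]
    refine ⟨0, ?_⟩
    rcases Nat.eq_zero_or_pos n with rfl | hn
    · -- `m = 1` by coprimality, and the equation of the curve becomes `z = 1`
      have hm1 : m = 1 := by simpa using hcop
      subst hm1
      rw [pow_one, pow_zero] at he
      exact Prod.ext (by simp [neilParam, he]) (by simp [neilParam, hw0])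
    · have hz0 : q.1 = 0 := by
        rw [hw0, zero_pow (by omega)] at he
        exact pow_eq_zero_iff hm0 |>.mp he
      exact Prod.ext (by simp [neilParam, hz0, show n ≠ 0 by omega])
        (by simp [neilParam, hw0, hm0])
  · -- `ω = z / s ^ n` is an `m`-th root of unity; an integer `k` with `k * n ≡ 1` modulo `m`
    -- gives the root of unity `ω ^ k` by which `s` has to be corrected
    set ω := q.1 / s ^ n with hω
    have hωm : ω ^ m = 1 := by
      rw [hω, div_pow, he, ← hs, ← pow_mul, ← pow_mul, mul_comm, div_self (pow_ne_zero _ hs0)]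
    have hω0 : ω ≠ 0 := by
      intro h; rw [h, zero_pow hm0] at hωm; exact zero_ne_one hωm
    have hb : (n : ℤ) * Nat.gcdB m n = 1 - m * Nat.gcdA m n := by
      have := Nat.gcd_eq_gcd_ab m n
      rw [hcop.gcd_eq_one] at this
      push_cast at this
      linarith
    refine ⟨s * ω ^ Nat.gcdB m n, Prod.ext ?_ ?_⟩
    · have h1 : (ω ^ Nat.gcdB m n) ^ n = ω := by
        rw [← zpow_natCast, ← zpow_mul, mul_comm, hb, zpow_sub₀ hω0, zpow_one, zpow_mul,
          zpow_natCast, hωm, one_zpow, div_one]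
      simp only [neilParam]
      rw [mul_pow, h1, hω, mul_div_cancel₀ _ (pow_ne_zero _ hs0)]
    · have h1 : (ω ^ Nat.gcdB m n) ^ m = 1 := by
        rw [← zpow_natCast, ← zpow_mul, mul_comm, zpow_mul, zpow_natCast, hωm, one_zpow]
      simp only [neilParam]
      rw [mul_pow, h1, mul_one, hs]

/-- Continuous curves in the Neil parabola lift to continuous curves in the parameter disc. -/
theorem exists_continuousOn_lift {m n : ℕ} (hm : 1 ≤ m) (hcop : Nat.Coprime m n)
    {α : ℝ → ℂ × ℂ} (hα : ContinuousOn α (Icc 0 1))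
    (hmaps : MapsTo α (Icc 0 1) (neilParabola m n)) :
    ∃ t : ℝ → ℂ, ContinuousOn t (Icc 0 1) ∧ ∀ x ∈ Icc (0 : ℝ) 1, ‖t x‖ < 1 ∧
      neilParam m n (t x) = α x := by
  have hex : ∀ x : ℝ, ∃ t : ℂ, x ∈ Icc (0 : ℝ) 1 → ‖t‖ < 1 ∧ neilParam m n t = α x := by
    intro x
    by_cases hx : x ∈ Icc (0 : ℝ) 1
    · obtain ⟨t, ht⟩ := exists_neilParam_eq hm hcop (hmaps hx)
      exact ⟨t, fun _ => ht⟩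
    · exact ⟨0, fun h => absurd h hx⟩
  choose t ht using hex
  refine ⟨t, ?_, ht⟩
  -- on the compact closed disc the injective map `neilParam` is an embedding
  let P : Metric.closedBall (0 : ℂ) 1 → ℂ × ℂ := fun z => neilParam m n z
  have hP : Topology.IsClosedEmbedding P := by
    have : CompactSpace (Metric.closedBall (0 : ℂ) 1) :=
      isCompact_iff_compactSpace.mp (isCompact_closedBall 0 1)
    refine Continuous.isClosedEmbedding
      ((differentiable_neilParam m n).continuous.comp continuous_subtype_val) ?_
    exact (neilParam_injective hm hcop).comp Subtype.val_injective
  rw [continuousOn_iff_continuous_domRestrict] at hα ⊢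
  let τ : Icc (0 : ℝ) 1 → Metric.closedBall (0 : ℂ) 1 := fun x =>
    ⟨t x, by simpa using (ht x x.2).1.le⟩
  have hτ : Continuous τ := by
    rw [hP.isInducing.continuous_iff]
    refine hα.congr fun x => ?_
    exact (ht x x.2).2.symm
  exact continuous_subtype_val.comp hτ

/-! ### Lower bound for the inner distance -/

/-- The hypothesis says that `w` is `‖w‖ * exp (πi / m)` or `‖w‖ * exp (-πi / m)`. -/
theorem pow_eq_neg_of_re_eq {m : ℕ} (hm : 1 ≤ m) {w : ℂ}
    (hw : w.re = Real.cos (Real.pi / m) * ‖w‖) : w ^ m = -((‖w‖ ^ m : ℝ) : ℂ) := by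
  have hmC : (m : ℂ) ≠ 0 := Nat.cast_ne_zero.mpr (by omega)
  have hsq : w.re ^ 2 + w.im ^ 2 = ‖w‖ ^ 2 := by
    rw [← Complex.normSq_eq_norm_sq, Complex.normSq_apply]; ring
  have him : w.im ^ 2 = (Real.sin (Real.pi / m) * ‖w‖) ^ 2 := by
    rw [mul_pow, Real.sin_sq]
    rw [hw] at hsq
    linarith
  have hπ : (m : ℂ) * (Real.pi / m * Complex.I) = Real.pi * Complex.I := by
    field_simp
  have hneg : (m : ℂ) * -(Real.pi / m * Complex.I) = -(Real.pi * Complex.I) := by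
    rw [mul_neg, hπ]
  have hexp : Complex.exp (Real.pi / m * Complex.I) =
      Real.cos (Real.pi / m) + Real.sin (Real.pi / m) * Complex.I := by
    rw [Complex.exp_mul_I]; push_cast; rfl
  have hexp' : Complex.exp (-(Real.pi / m * Complex.I)) =
      Real.cos (Real.pi / m) - Real.sin (Real.pi / m) * Complex.I := by
    rw [← neg_mul, Complex.exp_mul_I, Complex.cos_neg, Complex.sin_neg]; push_cast; ring
  rcases sq_eq_sq_iff_eq_or_eq_neg.mp him with h | h
  · have e : w = ‖w‖ * Complex.exp (Real.pi / m * Complex.I) := by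
      rw [hexp]
      apply Complex.ext
      · rw [Complex.re_ofReal_mul]; simp [hw, -Complex.ofReal_cos, -Complex.ofReal_sin]; ring
      · rw [Complex.im_ofReal_mul]; simp [h, -Complex.ofReal_cos, -Complex.ofReal_sin]; ring
    conv_lhs => rw [e]
    rw [mul_pow, ← Complex.exp_nat_mul, hπ, Complex.exp_pi_mul_I]
    push_cast; ring
  · have e : w = ‖w‖ * Complex.exp (-(Real.pi / m * Complex.I)) := by
      rw [hexp']
      apply Complex.ext
      · rw [Complex.re_ofReal_mul]; simp [hw, -Complex.ofReal_cos, -Complex.ofReal_sin]; ring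
      · rw [Complex.im_ofReal_mul]; simp [h, -Complex.ofReal_cos, -Complex.ofReal_sin]; ring
    conv_lhs => rw [e]
    rw [mul_pow, ← Complex.exp_nat_mul, hneg, Complex.exp_neg, Complex.exp_pi_mul_I]
    push_cast; norm_num

/-- If the angle between `a` and `b` exceeds `π / m`, every curve from `neilParam m n a` to
`neilParam m n b` is at least as long as the curve through the cusp: by the intermediate value
theorem it meets a point with parameter `c` such that `a ^ m` and `c ^ m` lie on opposite sides of
the origin. -/
theorem add_le_innerCaratheodoryDist {m n : ℕ} (hm : 1 ≤ m) (hmn : m ≤ n)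
    (hcop : Nat.Coprime m n) {a b : ℂ} (ha : ‖a‖ < 1) (hb : ‖b‖ < 1)
    (hab : (a * conj b).re < Real.cos (Real.pi / m) * ‖a * b‖) :
    ENNReal.ofReal (Real.artanh (‖a‖ ^ m) + Real.artanh (‖b‖ ^ m)) ≤
      innerCaratheodoryDist (neilParabola m n) (neilParam m n a) (neilParam m n b) := by
  refine le_iInf₂ fun α hα => ?_
  obtain ⟨hc, hmaps, -, h0, h1⟩ := hα
  obtain ⟨t, htc, ht⟩ := exists_continuousOn_lift hm hcop hc hmaps
  have h0I : (0 : ℝ) ∈ Icc (0 : ℝ) 1 := by simp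
  have h1I : (1 : ℝ) ∈ Icc (0 : ℝ) 1 := by simp
  have ht0 : t 0 = a := neilParam_injective hm hcop (by rw [(ht 0 h0I).2, h0])
  have ht1 : t 1 = b := neilParam_injective hm hcop (by rw [(ht 1 h1I).2, h1])
  set φ : ℝ → ℝ := fun x => (a * conj (t x)).re - Real.cos (Real.pi / m) * ‖a * t x‖ with hφ
  have hφc : ContinuousOn φ (Icc 0 1) := by
    have h2 : Continuous fun z : ℂ => (a * conj z).re - Real.cos (Real.pi / m) * ‖a * z‖ := by
      have := Complex.continuous_conj
      fun_prop
    exact h2.comp_continuousOn htc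
  have hφ0 : 0 ≤ φ 0 := by
    simp only [hφ, ht0]
    rw [Complex.mul_conj, Complex.ofReal_re, Complex.normSq_eq_norm_sq, norm_mul]
    nlinarith [Real.cos_le_one (Real.pi / m), mul_nonneg (norm_nonneg a) (norm_nonneg a)]
  have hφ1 : φ 1 ≤ 0 := by
    simp only [hφ, ht1]; linarith
  obtain ⟨s, hs, hs0⟩ := intermediate_value_Icc' zero_le_one hφc ⟨hφ1, hφ0⟩
  have hτ := (ht s hs).1
  set τ := t s with hτdef
  have hopp : a ^ m * conj (τ ^ m) = -((‖a ^ m‖ * ‖τ ^ m‖ : ℝ) : ℂ) := by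
    have hn : ‖a * conj τ‖ = ‖a * τ‖ := by simp
    have := pow_eq_neg_of_re_eq hm (w := a * conj τ) (by rw [hn]; simp only [hφ] at hs0; linarith)
    rw [map_pow, ← mul_pow, this, hn, norm_pow, norm_pow, norm_mul, mul_pow]
  have ham := norm_pow_lt_one hm ha
  have hbm := norm_pow_lt_one hm hb
  have hτm := norm_pow_lt_one hm hτ
  have hlen := ofReal_add_le_caratheodoryLength (X := neilParabola m n) (α := α) hs
  rw [h0, h1, ← (ht s hs).2] at hlen
  refine le_trans ?_ hlen
  rw [← ENNReal.ofReal_add caratheodoryDist_nonneg caratheodoryDist_nonneg]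
  refine ENNReal.ofReal_le_ofReal ?_
  have l1 := poincareDist_pow_le_caratheodoryDist hm hmn ha hτ
  have l2 := poincareDist_pow_le_caratheodoryDist hm hmn hτ hb
  rw [poincareDist_eq_add hopp ham hτm] at l1
  have l3 := poincareDist_triangle (a := 0) (by simp) hτm hbm
  rw [poincareDist, poincareDist, moebiusDist_zero_left, moebiusDist_zero_left] at l3
  rw [← norm_pow, ← norm_pow]
  linarith

/-- Beyond the angle `π / m` the Carathéodory distance is not inner, except for opposite points. -/
theorem ofReal_caratheodoryDist_lt_inner {m n : ℕ} (hm : 1 ≤ m) (hmn : m ≤ n)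
    (hcop : Nat.Coprime m n) {a b : ℂ} (ha : ‖a‖ < 1) (hb : ‖b‖ < 1)
    (hab : (a * conj b).re < Real.cos (Real.pi / m) * ‖a * b‖)
    (hneg : ¬ IsNegativeReal ((a * conj b) ^ m)) :
    ENNReal.ofReal (caratheodoryDist (neilParabola m n) (neilParam m n a) (neilParam m n b)) <
      innerCaratheodoryDist (neilParabola m n) (neilParam m n a) (neilParam m n b) := by
  have ha0 : a ≠ 0 := by rintro rfl; simp at hab
  have hb0 : b ≠ 0 := by rintro rfl; simp at hab
  refine lt_of_lt_of_le ?_ (add_le_innerCaratheodoryDist hm hmn hcop ha hb hab)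
  have h := caratheodoryDist_neilParam_lt_add hm hmn ha hb ha0 hb0 hneg
  exact (ENNReal.ofReal_lt_ofReal_iff (caratheodoryDist_nonneg.trans_lt h)).mpr h

/-! ### Upper bound for the inner distance -/

theorem eq_neg_norm_of_isNegativeReal {z : ℂ} (hz : IsNegativeReal z) : z = -((‖z‖ : ℝ) : ℂ) := by
  have h1 : z = (z.re : ℂ) := Complex.ext rfl (by simp [hz.1])
  have h2 : ‖z‖ = -z.re := by
    rw [h1, Complex.norm_real, Real.norm_of_nonpos hz.2.le, Complex.ofReal_re]
  rw [h2, Complex.ofReal_neg, neg_neg, ← h1]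

theorem innerCaratheodoryDist_le_poincareDist_pow {m n : ℕ} (hm : 1 ≤ m) (hmn : m ≤ n) {a b : ℂ}
    (ha : ‖a‖ < 1) (hb : ‖b‖ < 1)
    (hab : Real.cos (Real.pi / m) * ‖a * b‖ ≤ (a * conj b).re ∨ IsNegativeReal ((a * conj b) ^ m)) :
    innerCaratheodoryDist (neilParabola m n) (neilParam m n a) (neilParam m n b) ≤
      ENNReal.ofReal (poincareDist (a ^ m) (b ^ m)) := by
  have ham := norm_pow_lt_one hm ha
  have hbm := norm_pow_lt_one hm hb
  by_cases hopp : a ^ m * conj (b ^ m) = -((‖a ^ m‖ * ‖b ^ m‖ : ℝ) : ℂ)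
  · rw [poincareDist_eq_add hopp ham hbm, norm_pow, norm_pow]
    exact innerCaratheodoryDist_le_add hm hmn ha hb
  have hneg : ¬ IsNegativeReal ((a * conj b) ^ m) := by
    intro h
    refine hopp ?_
    have := eq_neg_norm_of_isNegativeReal h
    rw [map_pow, ← mul_pow, this]
    simp [mul_pow]
  have ha0 : a ≠ 0 := by rintro rfl; simp [show m ≠ 0 by omega] at hopp
  have hb0 : b ≠ 0 := by rintro rfl; simp [show m ≠ 0 by omega] at hopp
  have hre := hab.resolve_right hneg
  set w := b / a with hw
  have hbw : b = a * w := by rw [hw, mul_div_cancel₀ _ ha0]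
  have hw0 : w ≠ 0 := div_ne_zero hb0 ha0
  have hna : 0 < ‖a‖ := norm_pos_iff.mpr ha0
  have hnw : 0 < ‖w‖ := norm_pos_iff.mpr hw0
  have e1 : a * conj b = ((‖a‖ ^ 2 : ℝ) : ℂ) * conj w := by
    rw [hbw, map_mul, ← mul_assoc, Complex.mul_conj, Complex.normSq_eq_norm_sq]
  have hwre : Real.cos (Real.pi / m) * ‖w‖ ≤ w.re := by
    rw [e1, Complex.re_ofReal_mul, Complex.conj_re, hbw, norm_mul, norm_mul] at hre
    have : 0 < ‖a‖ ^ 2 := by positivity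
    nlinarith
  have hwneg : ¬ (w ^ m = -((‖w‖ ^ m : ℝ) : ℂ)) := by
    intro h
    refine hneg ?_
    have : (a * conj b) ^ m = ((-((‖a‖ ^ 2) ^ m * ‖w‖ ^ m) : ℝ) : ℂ) := by
      rw [e1, mul_pow, ← map_pow, h, map_neg, Complex.conj_ofReal]; push_cast; ring
    rw [this, IsNegativeReal, Complex.ofReal_im, Complex.ofReal_re]
    have : 0 < (‖a‖ ^ 2) ^ m * ‖w‖ ^ m := by positivity
    exact ⟨rfl, by linarith⟩
  have hπm0 : 0 ≤ Real.pi / m := by positivity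
  have hπm : Real.pi / m ≤ Real.pi := div_le_self Real.pi_pos.le (by exact_mod_cast hm)
  have harg : |w.arg| < Real.pi / m := by
    have hcos : Real.cos w.arg = w.re / ‖w‖ := Complex.cos_arg hw0
    refine lt_of_le_of_ne ?_ fun h => ?_
    · by_contra! h
      have := Real.cos_lt_cos_of_nonneg_of_le_pi hπm0 (Complex.abs_arg_le_pi w) h
      rw [Real.cos_abs, hcos, div_lt_iff₀ hnw] at this
      linarith
    · refine hwneg (pow_eq_neg_of_re_eq hm ?_)
      rw [← h, Real.cos_abs, hcos, div_mul_cancel₀ _ hnw.ne']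
  have hslit : w ^ m ∈ Complex.slitPlane := by
    rw [Complex.mem_slitPlane_iff]
    by_contra! h
    refine hwneg ?_
    have h1 : w ^ m = ((w ^ m).re : ℂ) := Complex.ext rfl (by simp [h.2])
    have h2 : ‖w ^ m‖ = -(w ^ m).re := by
      conv_lhs => rw [h1, Complex.norm_real, Real.norm_of_nonpos h.1]
    rw [← norm_pow, h2, Complex.ofReal_neg, neg_neg, ← h1]
  have h := abs_lt.mp harg
  rw [hbw] at hb ⊢
  exact innerCaratheodoryDist_le_poincareDist hm hmn ha hb ha0 hslit h.1 h.2.le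

/-! ### The comparison theorem -/

/-- For `m > 1` the points with parameters `1 / 2` and `exp (3πi / (2m)) / 2` are at angle greater
than `π / m`, while `(a * conj b) ^ m` is a positive multiple of `i`. -/
theorem exists_re_lt_and_not_isNegativeReal {m : ℕ} (hm : 1 < m) :
    ∃ a b : ℂ, ‖a‖ < 1 ∧ ‖b‖ < 1 ∧ (a * conj b).re < Real.cos (Real.pi / m) * ‖a * b‖ ∧
      ¬ IsNegativeReal ((a * conj b) ^ m) := by
  have hmR : (2 : ℝ) ≤ m := by exact_mod_cast hm
  have hmC : (m : ℂ) ≠ 0 := Nat.cast_ne_zero.mpr (by omega)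
  have hπ := Real.pi_pos
  set θ : ℝ := 3 * Real.pi / (2 * m) with hθ
  have hn : ‖Complex.exp (θ * Complex.I)‖ = 1 := Complex.norm_exp_ofReal_mul_I θ
  have hconj : conj (Complex.exp (θ * Complex.I)) = Complex.exp ((-θ : ℝ) * Complex.I) := by
    rw [← Complex.exp_conj]; simp
  have e : (1 / 2 : ℂ) * conj (1 / 2 * Complex.exp (θ * Complex.I)) =
      ((1 / 4 : ℝ) : ℂ) * Complex.exp ((-θ : ℝ) * Complex.I) := by
    rw [map_mul, hconj, map_div₀, map_one, map_ofNat]; push_cast; ring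
  refine ⟨1 / 2, 1 / 2 * Complex.exp (θ * Complex.I), by norm_num, ?_, ?_, ?_⟩
  · rw [norm_mul, hn]; norm_num
  · rw [e, Complex.re_ofReal_mul, Complex.exp_ofReal_mul_I_re, Real.cos_neg, norm_mul, norm_mul, hn]
    have h1 : Real.cos θ < Real.cos (Real.pi / m) := by
      refine Real.cos_lt_cos_of_nonneg_of_le_pi (by positivity) ?_ ?_
      · rw [hθ, div_le_iff₀ (by positivity)]; nlinarith
      · rw [hθ, div_lt_div_iff₀ (by positivity) (by positivity)]; nlinarith
    norm_num
    linarith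
  · have e2 : ((1 / 2 : ℂ) * conj (1 / 2 * Complex.exp (θ * Complex.I))) ^ m =
        (((1 / 4) ^ m : ℝ) : ℂ) * Complex.I := by
      have h1 : (m : ℂ) * ((-θ : ℝ) * Complex.I) =
          Real.pi / 2 * Complex.I - 2 * Real.pi * Complex.I := by
        rw [hθ]; push_cast; field_simp; ring
      rw [e, mul_pow, ← Complex.exp_nat_mul, h1, Complex.exp_sub, Complex.exp_two_pi_mul_I,
        Complex.exp_pi_div_two_mul_I]
      push_cast; ring
    rw [e2]
    intro h
    have := h.1
    rw [Complex.im_ofReal_mul, Complex.I_im, mul_one] at this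
    exact (by positivity : ((1 / 4 : ℝ) ^ m) ≠ 0) this

theorem corollary2 (m n : ℕ) (hm : 1 ≤ m) (hmn : m ≤ n) (hcop : Nat.Coprime m n) :
    (∀ lam ∈ unitDisc, ∀ mu ∈ unitDisc,
      -- part (a)
      (Real.cos (Real.pi / (m : ℝ)) * ‖lam * mu‖ ≤ (lam * conj mu).re →
        innerCaratheodoryDist (neilParabola m n) (neilParam m n lam) (neilParam m n mu) =
          ENNReal.ofReal
            (caratheodoryDist (neilParabola m n) (neilParam m n lam) (neilParam m n mu))) ∧
      -- part (b)
      ((lam * conj mu).re < Real.cos (Real.pi / (m : ℝ)) * ‖lam * mu‖ →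
        (innerCaratheodoryDist (neilParabola m n) (neilParam m n lam) (neilParam m n mu) =
          ENNReal.ofReal
            (caratheodoryDist (neilParabola m n) (neilParam m n lam) (neilParam m n mu)) ↔
          IsNegativeReal ((lam * conj mu) ^ m))) ∧
      -- the three equivalent conditions
      List.TFAE [
        innerCaratheodoryDist (neilParabola m n) (neilParam m n lam) (neilParam m n mu) =
          ENNReal.ofReal
            (caratheodoryDist (neilParabola m n) (neilParam m n lam) (neilParam m n mu)),
        innerCaratheodoryDist (neilParabola m n) (neilParam m n lam) (neilParam m n mu) =
          ENNReal.ofReal (caratheodoryDist unitDisc (lam ^ m) (mu ^ m)),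
        Real.cos (Real.pi / (m : ℝ)) * ‖lam * mu‖ ≤ (lam * conj mu).re ∨
          IsNegativeReal ((lam * conj mu) ^ m)]) ∧
    (1 < m → ¬ CaratheodoryDistIsInner (neilParabola m n)) := by
  have main : ∀ a b : ℂ, ‖a‖ < 1 → ‖b‖ < 1 →
      (Real.cos (Real.pi / m) * ‖a * b‖ ≤ (a * conj b).re ∨ IsNegativeReal ((a * conj b) ^ m) →
        innerCaratheodoryDist (neilParabola m n) (neilParam m n a) (neilParam m n b) ≤
          ENNReal.ofReal (poincareDist (a ^ m) (b ^ m))) ∧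
      (innerCaratheodoryDist (neilParabola m n) (neilParam m n a) (neilParam m n b) =
        ENNReal.ofReal (caratheodoryDist (neilParabola m n) (neilParam m n a) (neilParam m n b)) →
        Real.cos (Real.pi / m) * ‖a * b‖ ≤ (a * conj b).re ∨
          IsNegativeReal ((a * conj b) ^ m)) := by
    refine fun a b ha hb => ⟨innerCaratheodoryDist_le_poincareDist_pow hm hmn ha hb, fun h => ?_⟩
    by_contra! hcon
    exact (ofReal_caratheodoryDist_lt_inner hm hmn hcop ha hb hcon.1 hcon.2).ne' h
  refine ⟨fun a ha b hb => ?_, fun hm1 hinner => ?_⟩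
  · have ha' := mem_unitDisc.mp ha
    have hb' := mem_unitDisc.mp hb
    obtain ⟨hup, hlow⟩ := main a b ha' hb'
    have h1 := ENNReal.ofReal_le_ofReal (poincareDist_pow_le_caratheodoryDist hm hmn ha' hb')
    have h2 := ofReal_caratheodoryDist_le_inner (X := neilParabola m n) (neilParam m n a)
      (neilParam m n b)
    have heq := fun h => le_antisymm ((hup h).trans h1) h2
    refine ⟨fun h => heq (Or.inl h), fun h => ⟨fun hi => ?_, fun hn => heq (Or.inr hn)⟩, ?_⟩
    · exact (hlow hi).resolve_left (not_le.mpr h)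
    · rw [caratheodoryDist_unitDisc (norm_pow_lt_one hm ha') (norm_pow_lt_one hm hb')]
      tfae_have 1 → 3 := hlow
      tfae_have 3 → 2 := fun h => le_antisymm (hup h) (h1.trans h2)
      tfae_have 2 → 1 := fun h => le_antisymm (h.le.trans h1) h2
      tfae_finish
  · obtain ⟨a, b, ha, hb, hre, hneg⟩ := exists_re_lt_and_not_isNegativeReal hm1
    rcases (main a b ha hb).2 (hinner _ (neilParam_mem hm hmn ha) _ (neilParam_mem hm hmn hb))
      with h | h
    · exact absurd hre (not_lt.mpr h)
    · exact hneg h
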